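/- **Setting.** Let $L$ be a countable, computably given first-order language: its constants, its function symbols (of positive arity) and its relation symbols form decidable subsets of $\mathbb N$, and arities are computable; the variables are indexed by $\mathbb N$, and there is in addition a binary similarity symbol $\approx$. The formulas of $\mathrm{RPL}\forall$ are built from the truth constants $\bar r$ ($r\in\mathbb Q\cap[0,1]$) and from atomic formulas by $\to$ and $\forall$. Truth degrees lie in $[0,1]$, with $0$ the highest degree of truth: $\bar r$ has degree $r$, $\varphi\to\psi$ has degree $\max(\|\psi\|-\|\varphi\|,0)$, and $\forall$ is the supremum. Put $\bot:=\bar 1$, $\neg\varphi:=\varphi\to\bot$, $\varphi\oplus\psi:=\neg(\varphi\to\neg\psi)$, $\varphi\leftrightarrow\psi:=(\varphi\to\psi)\oplus(\psi\to\varphi)$, $\exists x\,\varphi:=\neg\forall x\,\neg\varphi$. The axioms are - $\varphi\to(\psi\to\varphi)$, $\ (\varphi\to\psi)\to((\psi\to\sigma)\to(\varphi\to\sigma))$, $\ ((\varphi\to\psi)\to\psi)\to((\psi\to\varphi)\to\varphi)$, $\ (\neg\varphi\to\neg\psi)\to(\psi\to\varphi)$; - $\forall x\,\varphi\to\varphi[t/x]$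 for $t$ free for $x$ in $\varphi$, and $\forall x(\varphi\to\psi)\to(\varphi\to\forall x\,\psi)$ for $x$ not free in $\varphi$; - $(\bar r\to\bar s)\leftrightarrow\overline{\max(s-r,0)}$; - $x\approx x$, $\ x\approx y\to y\approx x$, $\ (x\approx y\oplus y\approx z)\to x\approx z$; and the rules are modus ponens and generalization. For a theory (set of formulas) $T$ write $T\vdash\varphi$ for provability from $T$. The provability degree is $|\varphi|_T=\inf\{r\in\mathbb Q\cap[0,1]: T\vdash\bar r\to\varphi\}$. $T$ is *consistent* if $T\nvdash\bot$; *linear-complete* if for all sentences $\varphi,\psi$, $T\vdash\varphi\to\psi$ or $T\vdash\psi\to\varphi$; *Henkin* if for every sentence $\exists x\,\varphi$ with $T\vdash\exists x\,\varphi$ there is a constant $c$ with $T\vdash\varphi[c/x]$; *computably axiomatizable* if its set of axioms is computably enumerable. In a standard structure $M$ (non-empty universe; $\approx$ and the relations take values in $[0,1]$), $\|\varphi\|_M$ is the supremum of the truth degrees of $\varphi$ over all evaluations, and $M\models T$ means that every $\varphi\in T$ has degree $0$ under every evaluation. $M$ is *decidable* with respect to an injective numbering of its universe by natural numbers if the set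 of the numbers is decidable, the interpretations of constants and function symbols are computable, uniformly in the symbol, and the elementary diagram is computably enumerable. The elementary diagram is the set of the pairs of a sentence $\varphi$ with parameters from $M$ and an interval $[p,q]$, $p,q\in\mathbb Q\cap[0,1]$, with $\|\varphi\|_M$ in the interior of $[p,q]$ relative to $[0,1]$. **Theorem 3.5.** Let $T$ be a consistent, linear-complete, computably axiomatizable Henkin theory in $\mathrm{RPL}\forall$, in the language $L$. Then $T$ has a decidable model. More precisely: 1. $T$ has a model $M$ whose universe is the set of closed terms, in which every closed term denotes itself, $\approx$ is interpreted by the pseudo-metric $\rho(s,t)=|s\approx t|_T$, and $\|\varphi\|_M=|\varphi|_T$ for every sentence $\varphi$. $M$ is decidable with respect to the Gödel numbering of closed terms. 2. Suppose that $L$ has no function symbols, or that closed terms at distance $0$ are not distinguished by the symbols of $L$: whenever $s_1,t_1,\dots,s_n,t_n$ are closed terms with $|s_i\approx t_i|_T=0$ for all $i$, then $|R(\vec s)|_T=|R(\vec t)|_T$ for each $n$-ary relation symbol $R$ and $|f(\vec s)\approx f(\vec t)|_T=0$ for each $n$-ary function symbol $f$. Then $T$ has a model $M$ whose universe is the set $C$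 of constants of $L$, in which every constant denotes itself, $T\vdash f(\vec a)\approx f^M(\vec a)$ for every function symbol $f$ and all $\vec a$ in $C$, $\approx$ is interpreted by the pseudo-metric $\rho(a,b)=|a\approx b|_T$, and $\|\varphi\|_M=|\varphi|_T$ for every sentence $\varphi$. $M$ is decidable with respect to the given numbering of the constants. -/

import Mathlib

open scoped Topology

/-! First-order rational Pavelka logic, in the convention where `0` is full truth and `1` is full
falsity, with similarity (fuzzy equality), provability degrees, standard structures and their
effective presentations. -/

namespace RPL

/-- A countable first-order language: each kind of symbol forms a set of natural numbers. Every
language has, in addition, the binary similarity symbol, and the variables are indexed by `ℕ`. -/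
structure Lang where
  IsConst : ℕ → Prop
  IsFunc : ℕ → Prop
  IsRel : ℕ → Prop
  funcArity : ℕ → ℕ
  relArity : ℕ → ℕ
  funcArity_pos : ∀ f, IsFunc f → 0 < funcArity f

namespace Lang

/-- Constants. -/
def Const (L : Lang) : Type := {n : ℕ // L.IsConst n}

/-- Function symbols (of positive arity). -/
def Func (L : Lang) : Type := {n : ℕ // L.IsFunc n}

/-- Relation symbols. -/
def Rel (L : Lang) : Type := {n : ℕ // L.IsRel n}

/-- The language is computably given: its sets of symbols are decidable and the arities are
computable. -/
structure ComputablyGiven (L : Lang) : Prop where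
  const : ComputablePred L.IsConst
  func : ComputablePred L.IsFunc
  rel : ComputablePred L.IsRel
  funcArity : Computable L.funcArity
  relArity : Computable L.relArity

end Lang

/-- Rational numbers in `[0,1]`. -/
abbrev UnitRat : Type := Set.Icc (0 : ℚ) 1

namespace UnitRat

/-- Truncated subtraction `s ∸ r = max (s - r) 0`. -/
def tsub (s r : UnitRat) : UnitRat :=
  ⟨max (s.1 - r.1) 0, le_max_right _ _,
    max_le (by have h1 := s.2.2; have h2 := r.2.1; linarith) zero_le_one⟩

/-- Code of a rational number, through its reduced fraction. -/
def code (r : UnitRat) : ℕ := Nat.pair r.1.num.natAbs r.1.den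

end UnitRat

/-- Terms. -/
inductive Term (L : Lang) : Type
  | var (x : ℕ) : Term L
  | const (c : L.Const) : Term L
  | func (f : L.Func) (args : Fin (L.funcArity f.1) → Term L) : Term L

namespace Term

variable {L : Lang}

/-- The variable `x` occurs in the term. -/
def Occurs (x : ℕ) : Term L → Prop
  | var y => y = x
  | const _ => False
  | func _ a => ∃ i, (a i).Occurs x

/-- `subst x t s` is `s[t/x]`. -/
def subst (x : ℕ) (t : Term L) : Term L → Term L
  | var y => if y = x then t else var y
  | const c => const c
  | func f a => func f fun i => subst x t (a i)

/-- Gödel number of a term. -/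
def code : Term L → ℕ
  | var y => Nat.pair 0 y
  | const c => Nat.pair 1 c.1
  | func f a => Nat.pair 2 (Nat.pair f.1 (Encodable.encode (List.ofFn fun i => (a i).code)))

end Term

/-- Closed terms. -/
def ClosedTerm (L : Lang) : Type := {t : Term L // ∀ x, ¬ t.Occurs x}

/-- Formulas: rational truth constants, similarity, relations, implication and `∀`. -/
inductive Formula (L : Lang) : Type
  | rat (r : UnitRat) : Formula L
  | sim (s t : Term L) : Formula L
  | rel (R : L.Rel) (args : Fin (L.relArity R.1) → Term L) : Formula L
  | imp (φ ψ : Formula L) : Formula L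
  | all (x : ℕ) (φ : Formula L) : Formula L

namespace Formula

variable {L : Lang}

/-- `⊥` is the truth constant of the value `1`, absolute falsity. -/
def bot : Formula L := rat ⟨1, zero_le_one, le_rfl⟩

/-- `¬φ := φ → ⊥`. -/
def neg (φ : Formula L) : Formula L := imp φ bot

/-- `φ ⊕ ψ := ¬(φ → ¬ψ)`, with truth function `min (x + y) 1`. -/
def oplus (φ ψ : Formula L) : Formula L := neg (imp φ (neg ψ))

/-- `φ ↔ ψ := (φ → ψ) ⊕ (ψ → φ)`. -/
def iff (φ ψ : Formula L) : Formula L := oplus (imp φ ψ) (imp ψ φ)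

/-- `∃x φ := ¬∀x ¬φ`. -/
def ex (x : ℕ) (φ : Formula L) : Formula L := neg (all x (neg φ))

/-- The variable `x` is free in the formula. -/
def Free (x : ℕ) : Formula L → Prop
  | rat _ => False
  | sim s t => s.Occurs x ∨ t.Occurs x
  | rel _ a => ∃ i, (a i).Occurs x
  | imp φ ψ => φ.Free x ∨ ψ.Free x
  | all y φ => y ≠ x ∧ φ.Free x

/-- A sentence is a formula without free variables. -/
def IsSentence (φ : Formula L) : Prop := ∀ x, ¬ φ.Free x

/-- `φ.subst x t` replaces the free occurrences of `x` in `φ` by `t`. -/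
def subst (x : ℕ) (t : Term L) : Formula L → Formula L
  | rat r => rat r
  | sim s s' => sim (Term.subst x t s) (Term.subst x t s')
  | rel R a => rel R fun i => Term.subst x t (a i)
  | imp φ ψ => imp (φ.subst x t) (ψ.subst x t)
  | all y φ => if y = x then all y φ else all y (φ.subst x t)

/-- No variable of `t` becomes bound when `t` is substituted for `x`. -/
def FreeFor (t : Term L) (x : ℕ) : Formula L → Prop
  | rat _ => True
  | sim _ _ => True
  | rel _ _ => True
  | imp φ ψ => φ.FreeFor t x ∧ ψ.FreeFor t x
  | all y φ => ¬ (y ≠ x ∧ φ.Free x) ∨ (¬ t.Occurs y ∧ φ.FreeFor t x)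

/-- Gödel number of a formula. -/
def code : Formula L → ℕ
  | rat r => Nat.pair 0 r.code
  | sim s t => Nat.pair 1 (Nat.pair s.code t.code)
  | rel R a => Nat.pair 2 (Nat.pair R.1 (Encodable.encode (List.ofFn fun i => (a i).code)))
  | imp φ ψ => Nat.pair 3 (Nat.pair φ.code ψ.code)
  | all y φ => Nat.pair 4 (Nat.pair y φ.code)

end Formula

open Formula in
/-- `Provable T φ`: there is a proof of `φ` from `T` in first-order rational Pavelka logic. -/
inductive Provable {L : Lang} (T : Set (Formula L)) : Formula L → Prop
  | ax {φ} : φ ∈ T → Provable T φ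
  | l1 (φ ψ) : Provable T (imp φ (imp ψ φ))
  | l2 (φ ψ σ) : Provable T (imp (imp φ ψ) (imp (imp ψ σ) (imp φ σ)))
  | l3 (φ ψ) : Provable T (imp (imp (imp φ ψ) ψ) (imp (imp ψ φ) φ))
  | l4 (φ ψ) : Provable T (imp (imp (imp φ bot) (imp ψ bot)) (imp ψ φ))
  | all1 (x φ t) : FreeFor t x φ → Provable T (imp (all x φ) (φ.subst x t))
  | all2 (x φ ψ) : ¬ φ.Free x → Provable T (imp (all x (imp φ ψ)) (imp φ (all x ψ)))
  | book (r s : UnitRat) : Provable T (iff (imp (rat r) (rat s)) (rat (s.tsub r)))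
  | refl (x : ℕ) : Provable T (sim (Term.var x) (Term.var x))
  | symm (x y : ℕ) :
      Provable T (imp (sim (Term.var x) (Term.var y)) (sim (Term.var y) (Term.var x)))
  | trans (x y z : ℕ) :
      Provable T (imp (oplus (sim (Term.var x) (Term.var y)) (sim (Term.var y) (Term.var z)))
        (sim (Term.var x) (Term.var z)))
  | mp {φ ψ} : Provable T φ → Provable T (imp φ ψ) → Provable T ψ
  | gen (x) {φ} : Provable T φ → Provable T (all x φ)

section Theories

variable {L : Lang} (T : Set (Formula L))

/-- The provability degree: the infimum of the rationals `r` in `[0,1]` such that `T` proves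
`r → φ`. -/
noncomputable def provDeg (φ : Formula L) : ℝ :=
  sInf {x : ℝ | ∃ r : UnitRat, x = ((r.1 : ℚ) : ℝ) ∧ Provable T (Formula.imp (Formula.rat r) φ)}

def Consistent : Prop := ¬ Provable T Formula.bot

def LinearComplete : Prop :=
  ∀ φ ψ : Formula L, φ.IsSentence → ψ.IsSentence →
    Provable T (Formula.imp φ ψ) ∨ Provable T (Formula.imp ψ φ)

def IsHenkin : Prop :=
  ∀ (x : ℕ) (φ : Formula L), (Formula.ex x φ).IsSentence → Provable T (Formula.ex x φ) →
    ∃ c : L.Const, Provable T (φ.subst x (Term.const c))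

/-- The set of axioms is computably enumerable. -/
def ComputablyAxiomatizable : Prop :=
  REPred fun n : ℕ => ∃ φ ∈ T, φ.code = n

/-- Closed terms at distance `0` are not distinguished by relation and function symbols. -/
def Congruential : Prop :=
  (∀ (R : L.Rel) (s t : Fin (L.relArity R.1) → Term L),
    (∀ i x, ¬ (s i).Occurs x) → (∀ i x, ¬ (t i).Occurs x) →
    (∀ i, provDeg T (Formula.sim (s i) (t i)) = 0) →
      provDeg T (Formula.rel R s) = provDeg T (Formula.rel R t)) ∧
  (∀ (f : L.Func) (s t : Fin (L.funcArity f.1) → Term L),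
    (∀ i x, ¬ (s i).Occurs x) → (∀ i x, ¬ (t i).Occurs x) →
    (∀ i, provDeg T (Formula.sim (s i) (t i)) = 0) →
      provDeg T (Formula.sim (Term.func f s) (Term.func f t)) = 0)

end Theories

/-- A standard structure with universe `M`: similarity and relations take values in `[0,1]`. -/
structure Struc (L : Lang) (M : Type) where
  nonempty : Nonempty M
  const : L.Const → M
  func : (f : L.Func) → (Fin (L.funcArity f.1) → M) → M
  sim : M → M → unitInterval
  rel : (R : L.Rel) → (Fin (L.relArity R.1) → M) → unitInterval

namespace Struc

variable {L : Lang} {M : Type} (S : Struc L M)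

/-- Value of a term under an evaluation. -/
def termVal (v : ℕ → M) : Term L → M
  | Term.var x => v x
  | Term.const c => S.const c
  | Term.func f a => S.func f fun i => termVal v (a i)

/-- Truth degree of a formula under an evaluation. -/
noncomputable def eval : Formula L → (ℕ → M) → ℝ
  | Formula.rat r, _ => ((r.1 : ℚ) : ℝ)
  | Formula.sim s t, v => (S.sim (S.termVal v s) (S.termVal v t) : ℝ)
  | Formula.rel R a, v => (S.rel R fun i => S.termVal v (a i) : ℝ)
  | Formula.imp φ ψ, v => max (eval ψ v - eval φ v) 0
  | Formula.all x φ, v => ⨆ a : M, eval φ (Function.update v x a)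

/-- Truth degree of a formula in the structure: the supremum over all evaluations. -/
noncomputable def degree (φ : Formula L) : ℝ := ⨆ v : ℕ → M, S.eval φ v

/-- The structure is a model of `T`: all members of `T` have degree `0` under all evaluations. -/
def Models (T : Set (Formula L)) : Prop := ∀ φ ∈ T, ∀ v, S.eval φ v = 0

/-- The interpretation of similarity is a pseudo-metric. -/
def SimPseudoMetric : Prop :=
  (∀ a, (S.sim a a : ℝ) = 0) ∧ (∀ a b, (S.sim a b : ℝ) = S.sim b a) ∧
    ∀ a b c, (S.sim a c : ℝ) ≤ S.sim a b + S.sim b c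

end Struc

/-- The rational interval `[p,q]` approximates the point `x` in the domain of closed subintervals of
`[0,1]`: the point lies in the interior of `[p,q]` relative to `[0,1]`. -/
def Approximates (p q : UnitRat) (x : ℝ) : Prop :=
  Set.Icc ((p.1 : ℚ) : ℝ) ((q.1 : ℚ) : ℝ) ∈ 𝓝[Set.Icc (0 : ℝ) 1] x

/-- The structure is decidable when its elements are numbered by `ν`: the universe is a decidable
set, the constants and functions are computable, and the elementary diagram is computably
enumerable. A sentence with parameters from the universe is a formula together with the list of
the parameters assigned to the variables `0, …, n - 1`, among which are its free variables. The
diagram holds the pairs of such a sentence and a rational interval approximating its degree. -/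
structure Struc.DecidableVia {L : Lang} {M : Type} (S : Struc L M) (ν : M → ℕ) : Prop where
  injective : Function.Injective ν
  universe_decidable : ComputablePred fun n => ∃ a, ν a = n
  const : ∃ g : ℕ → ℕ, Computable g ∧ ∀ c : L.Const, g c.1 = ν (S.const c)
  func : ∃ g : ℕ × List ℕ → ℕ, Computable g ∧
    ∀ (f : L.Func) (a : Fin (L.funcArity f.1) → M),
      g (f.1, List.ofFn fun i => ν (a i)) = ν (S.func f a)
  diagram : REPred fun w : ℕ × List ℕ × ℕ × ℕ =>
    ∃ (φ : Formula L) (n : ℕ) (v : ℕ → M) (p q : UnitRat),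
      (∀ x, φ.Free x → x < n) ∧
      w = (φ.code, (List.range n).map (fun i => ν (v i)), p.code, q.code) ∧
      Approximates p q (S.eval φ v)

end RPL

/-! In a linear-complete theory the sentences are linearly preordered by provable implication, so
the provability degree commutes with `→`. The Henkin property, applied to a rational strictly
between the supremum of the degrees of the instances and the degree of `∀x φ`, shows that it
commutes with `∀` over the constants. Hence every degree is a provability degree in any structure
whose elements are named by closed terms, among them all constants, and whose atomic degrees are
provability degrees.

Provability is computably enumerable, and by linear completeness both strict upper and strict lower
rational bounds on the degree of a sentence are witnessed by proofs; this enumerates the elementary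
diagram. The Henkin property also makes every closed term provably similar to a constant. Choosing
the constant by a search through the proofs is computable and gives the functions of the structure
on the constants. -/

attribute [fun_prop] Computable

namespace RPL

theorem natRec_getElem?_eq_foldl_take {β σ : Type*} (h : σ → β → σ) (s : σ) (l : List β)
    (n : ℕ) :
    Nat.rec (motive := fun _ => σ) s (fun i s => (l[i]?).elim s (h s)) n =
      (l.take n).foldl h s := by
  induction n with
  | zero => simp
  | succ n ih => cases hn : l[n]? <;> simp [ih, List.take_add_one, List.foldl_append, hn]

section Computability

variable {α β γ σ : Type*} [Primcodable α] [Primcodable β] [Primcodable γ] [Primcodable σ]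

@[fun_prop] theorem computable_id : Computable fun a : α => a := Computable.id

@[fun_prop] theorem computable_const (s : σ) : Computable fun _ : α => s := Computable.const s

@[fun_prop] theorem computable_comp {f : β → σ} {g : α → β} (hf : Computable f)
    (hg : Computable g) : Computable fun a => f (g a) := hf.comp hg

@[fun_prop] theorem computable_mk {f : α → β} {g : α → γ} (hf : Computable f)
    (hg : Computable g) : Computable fun a => (f a, g a) := hf.pair hg

@[fun_prop] theorem computable_fst {f : α → β × γ} (hf : Computable f) :
    Computable fun a => (f a).1 := Computable.fst.comp hf

@[fun_prop] theorem computable_snd {f : α → β × γ} (hf : Computable f) :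
    Computable fun a => (f a).2 := Computable.snd.comp hf

@[fun_prop] theorem computable_natPair {f g : α → ℕ} (hf : Computable f) (hg : Computable g) :
    Computable fun a => Nat.pair (f a) (g a) := Primrec₂.natPair.to_comp.comp hf hg

@[fun_prop] theorem computable_unpair {f : α → ℕ} (hf : Computable f) :
    Computable fun a => (f a).unpair := Computable.unpair.comp hf

@[fun_prop] theorem computable_cond {c : α → Bool} {f g : α → σ} (hc : Computable c)
    (hf : Computable f) (hg : Computable g) : Computable fun a => bif c a then f a else g a :=
  hc.cond hf hg

@[fun_prop] theorem computable_some {f : α → β} (hf : Computable f) :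
    Computable fun a => some (f a) := Computable.option_some.comp hf

@[fun_prop] theorem computable_getD {f : α → Option β} {d : α → β} (hf : Computable f)
    (hd : Computable d) : Computable fun a => (f a).getD (d a) := hf.option_getD hd

@[fun_prop] theorem computable_bind {f : α → Option β} {g : α → β → Option σ} (hf : Computable f)
    (hg : Computable fun p : α × β => g p.1 p.2) : Computable fun a => (f a).bind (g a) :=
  hf.option_bind hg

@[fun_prop] theorem computable_elim {f : α → Option β} {d : α → σ} {g : α → β → σ}
    (hf : Computable f) (hd : Computable d) (hg : Computable fun p : α × β => g p.1 p.2) :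
    Computable fun a => (f a).elim (d a) (g a) :=
  (Computable.option_casesOn hf hd hg).of_eq fun a => by cases f a <;> rfl

@[fun_prop] theorem computable_and {f g : α → Bool} (hf : Computable f) (hg : Computable g) :
    Computable fun a => f a && g a := Primrec.and.to_comp.comp hf hg

@[fun_prop] theorem computable_or {f g : α → Bool} (hf : Computable f) (hg : Computable g) :
    Computable fun a => f a || g a := Primrec.or.to_comp.comp hf hg

@[fun_prop] theorem computable_not {f : α → Bool} (hf : Computable f) :
    Computable fun a => !f a := Primrec.not.to_comp.comp hf

@[fun_prop] theorem computable_beq [BEq β] [LawfulBEq β] {f g : α → β} (hf : Computable f)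
    (hg : Computable g) : Computable fun a => f a == g a := by
  classical
  exact (Primrec.eq.decide.to_comp.comp hf hg).of_eq fun a => by rw [Bool.eq_iff_iff]; simp

@[fun_prop] theorem computable_ble {f g : α → ℕ} (hf : Computable f) (hg : Computable g) :
    Computable fun a => (f a).ble (g a) :=
  (Primrec.nat_le.decide.to_comp.comp hf hg).of_eq fun a => by rw [Bool.eq_iff_iff]; simp

@[fun_prop] theorem computable_add {f g : α → ℕ} (hf : Computable f) (hg : Computable g) :
    Computable fun a => f a + g a := Primrec.nat_add.to_comp.comp hf hg

@[fun_prop] theorem computable_sub {f g : α → ℕ} (hf : Computable f) (hg : Computable g) :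
    Computable fun a => f a - g a := Primrec.nat_sub.to_comp.comp hf hg

@[fun_prop] theorem computable_mul {f g : α → ℕ} (hf : Computable f) (hg : Computable g) :
    Computable fun a => f a * g a := Primrec.nat_mul.to_comp.comp hf hg

@[fun_prop] theorem computable_mod {f g : α → ℕ} (hf : Computable f) (hg : Computable g) :
    Computable fun a => f a % g a := Primrec.nat_mod.to_comp.comp hf hg

@[fun_prop] theorem computable_encode {f : α → β} (hf : Computable f) :
    Computable fun a => Encodable.encode (f a) := Computable.encode.comp hf

@[fun_prop] theorem computable_decode {f : α → ℕ} (hf : Computable f) :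
    Computable fun a => (Encodable.decode (f a) : Option β) := Computable.decode.comp hf

@[fun_prop] theorem computable_ofNat_list {f : α → ℕ} (hf : Computable f) :
    Computable fun a => Denumerable.ofNat (List ℕ) (f a) :=
  Computable.option_some_iff.1 <| (Computable.decode.comp hf).of_eq fun a => by
    rw [Denumerable.decode_eq_ofNat]

@[fun_prop] theorem computable_cons {f : α → β} {g : α → List β} (hf : Computable f)
    (hg : Computable g) : Computable fun a => f a :: g a := Computable.list_cons.comp hf hg

@[fun_prop] theorem computable_append {f g : α → List β} (hf : Computable f)
    (hg : Computable g) : Computable fun a => f a ++ g a := Computable.list_append.comp hf hg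

@[fun_prop] theorem computable_length {f : α → List β} (hf : Computable f) :
    Computable fun a => (f a).length := Computable.list_length.comp hf

@[fun_prop] theorem computable_range {f : α → ℕ} (hf : Computable f) :
    Computable fun a => List.range (f a) := Primrec.list_range.to_comp.comp hf

@[fun_prop] theorem computable_getElem? {f : α → List β} {g : α → ℕ} (hf : Computable f)
    (hg : Computable g) : Computable fun a => (f a)[g a]? := Computable.list_getElem?.comp hf hg

@[fun_prop] theorem computable_natRec {f : α → ℕ} {g : α → σ} {h : α → ℕ → σ → σ}
    (hf : Computable f) (hg : Computable g)
    (hh : Computable fun p : α × ℕ × σ => h p.1 p.2.1 p.2.2) :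
    Computable fun a => Nat.rec (motive := fun _ => σ) (g a) (h a) (f a) :=
  Computable.nat_rec (h := fun a p => h a p.1 p.2) hf hg hh

@[fun_prop] theorem computable_foldl {f : α → List β} {g : α → σ} {h : α → σ → β → σ}
    (hf : Computable f) (hg : Computable g)
    (hh : Computable fun p : α × σ × β => h p.1 p.2.1 p.2.2) :
    Computable fun a => (f a).foldl (h a) (g a) := by
  have : Computable fun p : (α × ℕ × σ) × β => h p.1.1 p.1.2.2 p.2 :=
    hh.comp (g := fun p : (α × ℕ × σ) × β => (p.1.1, p.1.2.2, p.2)) (by fun_prop)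
  have iterate : Computable fun a => Nat.rec (motive := fun _ => σ) (g a)
      (fun i s => ((f a)[i]?).elim s (h a s)) (f a).length := by
    fun_prop
  exact iterate.of_eq fun a => by rw [natRec_getElem?_eq_foldl_take, List.take_length]

@[fun_prop] theorem computable_flatMap {f : α → List β} {g : α → β → List σ} (hf : Computable f)
    (hg : Computable fun p : α × β => g p.1 p.2) : Computable fun a => (f a).flatMap (g a) := by
  have : Computable fun p : α × List σ × β => g p.1 p.2.2 :=
    hg.comp (g := fun p : α × List σ × β => (p.1, p.2.2)) (by fun_prop)
  have fold : Computable fun a => (f a).foldl (fun s b => s ++ g a b) [] := by fun_prop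
  refine fold.of_eq fun a => ?_
  rw [List.flatMap_eq_foldl]

@[fun_prop] theorem computable_map {f : α → List β} {g : α → β → σ} (hf : Computable f)
    (hg : Computable fun p : α × β => g p.1 p.2) : Computable fun a => (f a).map (g a) := by
  have : Computable fun a => (f a).flatMap (fun b => [g a b]) := by fun_prop
  exact this.of_eq fun a => List.map_eq_flatMap.symm

@[fun_prop] theorem computable_filter {f : α → List β} {g : α → β → Bool} (hf : Computable f)
    (hg : Computable fun p : α × β => g p.1 p.2) : Computable fun a => (f a).filter (g a) := by
  have : Computable fun a => (f a).flatMap fun b => bif g a b then [b] else [] := by fun_prop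
  refine this.of_eq fun a => ?_
  induction f a with
  | nil => rfl
  | cons b l ih => cases h : g a b <;> simp [List.flatMap_cons, h, ih]

@[fun_prop] theorem computable_all {f : α → List β} {g : α → β → Bool} (hf : Computable f)
    (hg : Computable fun p : α × β => g p.1 p.2) : Computable fun a => (f a).all (g a) := by
  have : Computable fun a => ((f a).filter fun b => !g a b).length == 0 := by fun_prop
  refine this.of_eq fun a => ?_
  rw [Bool.eq_iff_iff]
  simp

@[fun_prop] theorem computable_elem {f : α → ℕ} {g : α → List ℕ}
    (hf : Computable f) (hg : Computable g) : Computable fun a => (g a).elem (f a) := by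
  have : Computable fun a => !(g a).all fun b => !(b == f a) := by fun_prop
  refine this.of_eq fun a => ?_
  rw [Bool.eq_iff_iff]
  simp

/-- The history of a course-of-values recursion is defined by ordinary recursion. -/
theorem exists_computable_strongRec {g : α → List σ → σ}
    (hg : Computable fun p : α × List σ => g p.1 p.2) :
    ∃ f : α → ℕ → σ, (Computable fun p : α × ℕ => f p.1 p.2) ∧
      ∀ a n, f a n = g a ((List.range n).map (f a)) := by
  let hist : α → ℕ → List σ := fun a n =>
    Nat.rec (motive := fun _ => List σ) [] (fun _ l => l ++ [g a l]) n
  have hist_eq : ∀ a n, hist a n = (List.range n).map fun m => g a (hist a m) := by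
    intro a n
    induction n with
    | zero => rfl
    | succ n ih =>
      change hist a n ++ [g a (hist a n)] = _
      rw [List.range_succ, List.map_append, ← ih, List.map_singleton]
  have : Computable fun p : (α × ℕ) × ℕ × List σ => p.2.2 ++ [g p.1.1 p.2.2] := by
    have := hg.comp (g := fun p : (α × ℕ) × ℕ × List σ => (p.1.1, p.2.2)) (by fun_prop)
    fun_prop
  exact ⟨fun a n => g a (hist a n), by fun_prop, fun a n => congrArg (g a) (hist_eq a n)⟩

theorem computablePred_iff_exists_computable {p : α → Prop} :
    ComputablePred p ↔ ∃ d : α → Bool, Computable d ∧ ∀ a, d a = true ↔ p a := by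
  rw [ComputablePred.computable_iff]
  exact exists_congr fun d => and_congr_right fun _ =>
    ⟨fun h a => by rw [h], fun h => funext fun a => propext (h a).symm⟩

theorem rePred_iff_exists_computable {p : α → Prop} :
    REPred p ↔ ∃ q : α × ℕ → Bool, Computable q ∧ ∀ a, p a ↔ ∃ k, q (a, k) = true := by
  constructor
  · intro h
    obtain ⟨c, hc⟩ := Nat.Partrec.Code.exists_code.1 h
    refine ⟨fun x => (Nat.Partrec.Code.evaln x.2 c (Encodable.encode x.1)).isSome, ?_, fun a => ?_⟩
    · have evaln := Nat.Partrec.Code.primrec_evaln.to_comp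
      exact Primrec.option_isSome.to_comp.comp (evaln.comp
        (g := fun x : α × ℕ => ((x.2, c), Encodable.encode x.1)) (by fun_prop))
    · have dom : p a ↔ (Nat.Partrec.Code.eval c (Encodable.encode a)).Dom := by
        rw [hc]; simp [Part.dom_iff_mem]
      simp only [dom, Part.dom_iff_mem, Nat.Partrec.Code.evaln_complete,
        Option.isSome_iff_exists, Option.mem_def]
      exact exists_comm
  · rintro ⟨q, hq, h⟩
    have search : Partrec fun a : α => Nat.rfind ((fun k => q (a, k) : ℕ → Bool) : ℕ →. Bool) :=
      Partrec.rfind (Computable.partrec (f := fun x : α × ℕ => q (x.1, x.2)) (by simpa using hq))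
    refine search.dom_re.of_eq fun a => ?_
    rw [h]
    exact Nat.rfind_dom'.trans (by simp)

theorem rePred_eq {f g : α → β} (hf : Computable f) (hg : Computable g) :
    REPred fun a => f a = g a :=
  open scoped Classical in
  ComputablePred.to_re ⟨inferInstance, Computable.of_eq
    (by fun_prop : Computable fun a => f a == g a) fun _ => rfl⟩

theorem rePred_comp {p : β → Prop} (hp : REPred p) {f : α → β} (hf : Computable f) :
    REPred fun a => p (f a) :=
  Partrec.comp hp hf

theorem rePred_exists {p : α → β → Prop} (hp : REPred fun x : α × β => p x.1 x.2) :
    REPred fun a => ∃ b, p a b := by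
  obtain ⟨q, hq, h⟩ := rePred_iff_exists_computable.1 hp
  refine rePred_iff_exists_computable.2 ⟨fun x =>
    ((Encodable.decode x.2.unpair.1 : Option β)).elim false fun b => q ((x.1, b), x.2.unpair.2),
    by fun_prop, fun a => ⟨?_, ?_⟩⟩
  · rintro ⟨b, hb⟩
    obtain ⟨k, hk⟩ := (h (a, b)).1 hb
    exact ⟨Nat.pair (Encodable.encode b) k, by simpa using hk⟩
  · rintro ⟨k, hk⟩
    cases hd : (Encodable.decode k.unpair.1 : Option β) with
    | none => simp [hd] at hk
    | some b => exact ⟨b, (h (a, b)).2 ⟨k.unpair.2, by simpa [hd] using hk⟩⟩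

theorem rePred_and {p q : α → Prop} (hp : REPred p) (hq : REPred q) :
    REPred fun a => p a ∧ q a := by
  refine (Partrec.bind hp (rePred_comp hq Computable.fst).to₂).of_eq fun a => ?_
  ext
  simp [Part.mem_bind_iff, Part.mem_assert_iff]

theorem rePred_or {p q : α → Prop} (hp : REPred p) (hq : REPred q) :
    REPred fun a => p a ∨ q a := by
  obtain ⟨f, hf, hfp⟩ := rePred_iff_exists_computable.1 hp
  obtain ⟨g, hg, hgq⟩ := rePred_iff_exists_computable.1 hq
  refine rePred_iff_exists_computable.2 ⟨fun x => f x || g x, by fun_prop, fun a => ?_⟩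
  rw [hfp, hgq]
  simp [exists_or]

theorem exists_computable_enumeration {p : α → Prop} (hp : REPred p) :
    ∃ e : ℕ → Option α, Computable e ∧ ∀ a, p a ↔ ∃ k, e k = some a := by
  obtain ⟨q, hq, h⟩ := rePred_iff_exists_computable.1 hp
  refine ⟨fun k => (Encodable.decode k.unpair.1 : Option α).bind fun a =>
    bif q (a, k.unpair.2) then some a else none, by fun_prop, fun a => ?_⟩
  rw [h]
  constructor
  · rintro ⟨k, hk⟩
    exact ⟨Nat.pair (Encodable.encode a) k, by simp [hk]⟩
  · rintro ⟨k, hk⟩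
    obtain ⟨b, -, hb⟩ := Option.bind_eq_some_iff.1 hk
    cases hq' : q (b, k.unpair.2) <;> simp only [hq', cond_false, cond_true, reduceCtorEq] at hb
    exact ⟨_, Option.some.inj hb ▸ hq'⟩

theorem exists_computable_choice {r : α → ℕ → Prop} (hr : REPred fun x : α × ℕ => r x.1 x.2)
    {d : α → Bool} (hd : Computable d) (H : ∀ a, d a = true → ∃ n, r a n) :
    ∃ g : α → ℕ, Computable g ∧ ∀ a, d a = true → r a (g a) := by
  obtain ⟨q, hq, h⟩ := rePred_iff_exists_computable.1 hr
  let found : α → ℕ → Bool := fun a k => !d a || q ((a, k.unpair.1), k.unpair.2)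
  have total : ∀ a, ∃ k, found a k = true := by
    intro a
    cases hda : d a with
    | false => simp [found, hda]
    | true =>
      obtain ⟨n, hn⟩ := H a hda
      obtain ⟨k, hk⟩ := (h (a, n)).1 hn
      exact ⟨Nat.pair n k, by simpa [found, hda] using hk⟩
  have computable_found : Computable fun x : α × ℕ => found x.1 x.2 := by fun_prop
  obtain ⟨g, hg, spec⟩ : ∃ g : α → ℕ, Computable g ∧ ∀ a, found a (g a) = true :=
    ⟨_, Computable.find (P := fun a k => found a k = true)
      (Computable.computablePred (by simpa using computable_found)) total,
      fun a => Nat.find_spec (total a)⟩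
  refine ⟨fun a => (g a).unpair.1, by fun_prop, fun a ha => (h (a, _)).2 ⟨(g a).unpair.2, ?_⟩⟩
  simpa [found, ha] using spec a

/-- The least predicate that contains `A` and is closed under the partial binary rules `R k`. -/
inductive RuleClosure (A : α → Prop) (R : ℕ → α → α → Option α) : α → Prop
  | base {a} : A a → RuleClosure A R a
  | step {k a b c} : RuleClosure A R a → RuleClosure A R b → R k a b = some c → RuleClosure A R c

theorem lt_natPair_of_le {a b c : ℕ} (ha : 0 < a) (h : c ≤ b) : c < Nat.pair a b := by
  unfold Nat.pair
  split_ifs <;> nlinarith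

/-- Derivations are numbered: `⟨0, k⟩` is the `k`-th element of the base and `⟨k + 1, ⟨i, j⟩⟩` is
the `k`-th rule applied to the conclusions of the derivations `i` and `j`. -/
theorem exists_computable_conclusion {e : ℕ → Option α} {R : ℕ → α → α → Option α}
    (he : Computable e) (hR : Computable fun p : ℕ × α × α => R p.1 p.2.1 p.2.2) :
    ∃ f : ℕ → Option α, Computable f ∧ (∀ k, f (Nat.pair 0 k) = e k) ∧
      ∀ k i j, f (Nat.pair (k + 1) (Nat.pair i j)) =
        (f i).bind fun a => (f j).bind fun b => R k a b := by
  let concl : List (Option α) → ℕ → Option α := fun hist d =>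
    bif d.unpair.1 == 0 then e d.unpair.2 else
      (hist[d.unpair.2.unpair.1]?.getD none).bind fun a =>
        (hist[d.unpair.2.unpair.2]?.getD none).bind fun b => R (d.unpair.1 - 1) a b
  have hconcl : Computable fun x : Unit × List (Option α) => concl x.2 x.2.length := by
    have : Computable fun x : ((Unit × List (Option α)) × α) × α =>
        R (x.1.1.2.length.unpair.1 - 1) x.1.2 x.2 :=
      hR.comp (g := fun x : ((Unit × List (Option α)) × α) × α =>
        (x.1.1.2.length.unpair.1 - 1, x.1.2, x.2)) (by fun_prop)
    fun_prop
  obtain ⟨f, hf, hrec⟩ := exists_computable_strongRec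
    (g := fun (_ : Unit) hist => concl hist hist.length) hconcl
  refine ⟨f (), hf.comp (g := fun d => ((), d)) (by fun_prop), fun k => ?_, fun k i j => ?_⟩
  · rw [hrec]
    simp [concl]
  · have hi := lt_natPair_of_le k.succ_pos (Nat.left_le_pair i j)
    have hj := lt_natPair_of_le k.succ_pos (Nat.right_le_pair i j)
    rw [hrec]
    simp [concl, hi, hj]

theorem rePred_ruleClosure {A : α → Prop} {R : ℕ → α → α → Option α} (hA : REPred A)
    (hR : Computable fun p : ℕ × α × α => R p.1 p.2.1 p.2.2) : REPred (RuleClosure A R) := by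
  obtain ⟨e, he, heA⟩ := exists_computable_enumeration hA
  obtain ⟨f, hf, f_base, f_step⟩ := exists_computable_conclusion he hR
  have hrange : REPred fun a => ∃ d, f d = some a :=
    rePred_exists (rePred_eq (f := fun x : α × ℕ => f x.2) (g := fun x => some x.1)
      (hf.comp (by fun_prop)) (by fun_prop))
  refine hrange.of_eq fun n => ⟨?_, fun h => ?_⟩
  · rintro ⟨d, hd⟩
    induction d using Nat.strong_induction_on generalizing n with
    | _ d ih =>
      rw [← Nat.pair_unpair d] at hd
      cases hk : d.unpair.1 with
      | zero => exact .base ((heA n).2 ⟨d.unpair.2, by rw [← f_base, ← hk, hd]⟩)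
      | succ k =>
        rw [hk, ← Nat.pair_unpair d.unpair.2, f_step] at hd
        obtain ⟨a, ha, hd⟩ := Option.bind_eq_some_iff.1 hd
        obtain ⟨b, hb, hc⟩ := Option.bind_eq_some_iff.1 hd
        have lt : ∀ m ≤ d.unpair.2, m < d := fun m hm => by
          rw [← Nat.pair_unpair d, hk]; exact lt_natPair_of_le k.succ_pos hm
        exact .step (ih _ (lt _ (Nat.unpair_left_le _)) a ha)
          (ih _ (lt _ (Nat.unpair_right_le _)) b hb) hc
  · induction h with
    | base h =>
      obtain ⟨k, hk⟩ := (heA _).1 h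
      exact ⟨Nat.pair 0 k, (f_base k).trans hk⟩
    | @step k a b c _ _ hR iha ihb =>
      obtain ⟨i, hi⟩ := iha
      obtain ⟨j, hj⟩ := ihb
      exact ⟨Nat.pair (k + 1) (Nat.pair i j), by simp only [f_step, hi, hj, Option.bind_some, hR]⟩

end Computability

section Codes

variable {α β X Y : Type*} [Primcodable α] [Primcodable β]

/-- A Gödel numbering of the elements of `X` with a decidable set of codes. -/
class GodelNumbering (X : Type*) extends Inhabited X where
  code : X → ℕ
  code_injective : Function.Injective code
  computablePred_code : ComputablePred fun n => ∃ x, code x = n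

/-- Computability of a function whose values are presented by their Gödel numbers. -/
@[fun_prop]
def Effective [GodelNumbering X] (f : α → X) : Prop :=
  Computable fun a => GodelNumbering.code (f a)

variable [GodelNumbering X]

/-- The object with a given Gödel number, and a default one for a number that is no code. -/
noncomputable def decode (X : Type*) [GodelNumbering X] (n : ℕ) : X :=
  open scoped Classical in
  if h : ∃ x : X, GodelNumbering.code x = n then h.choose else default

theorem code_decode {n : ℕ} (h : ∃ x : X, GodelNumbering.code x = n) :
    GodelNumbering.code (decode X n) = n := by
  rw [decode, dif_pos h, h.choose_spec]

theorem decode_of_not_exists {n : ℕ} (h : ¬ ∃ x : X, GodelNumbering.code x = n) :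
    decode X n = default :=
  dif_neg h

theorem decode_code (x : X) : decode X (GodelNumbering.code x) = x :=
  GodelNumbering.code_injective (code_decode ⟨x, rfl⟩)

@[fun_prop] theorem effective_const (x : X) : Effective fun _ : α => x :=
  Computable.const _

@[fun_prop] theorem effective_comp {f : β → X} {g : α → β} (hf : Effective f)
    (hg : Computable g) : Effective fun a => f (g a) :=
  Computable.comp (f := fun b => GodelNumbering.code (f b)) hf hg

@[fun_prop] theorem effective_decode {f : α → ℕ} (hf : Computable f) :
    Effective fun a => decode X (f a) := by
  obtain ⟨isCode, hisCode, h⟩ :=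
    computablePred_iff_exists_computable.1 (GodelNumbering.computablePred_code (X := X))
  have : Computable fun a => bif isCode (f a) then f a else GodelNumbering.code (default : X) := by
    fun_prop
  refine this.of_eq fun a => ?_
  cases hc : isCode (f a) with
  | true => exact (code_decode ((h _).1 hc)).symm
  | false =>
    have hnot : ¬ ∃ x : X, GodelNumbering.code x = f a :=
      fun hex => Bool.false_ne_true (hc.symm.trans ((h _).2 hex))
    exact congrArg GodelNumbering.code (decode_of_not_exists hnot).symm

theorem rePred_exists_decode {p : α → X → Prop}
    (hp : REPred fun q : α × ℕ => p q.1 (decode X q.2)) : REPred fun a => ∃ x, p a x :=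
  (rePred_exists (p := fun a n => p a (decode X n)) hp).of_eq fun _ =>
    ⟨fun ⟨_, h⟩ => ⟨_, h⟩, fun ⟨x, h⟩ => ⟨GodelNumbering.code x, by rwa [decode_code]⟩⟩

end Codes

section UnitRat

theorem UnitRat.code_injective : Function.Injective UnitRat.code := by
  intro r s h
  obtain ⟨hnum, hden⟩ := Nat.pair_eq_pair.1 h
  refine Subtype.ext (Rat.ext ?_ hden)
  have hr := Rat.num_nonneg.2 r.2.1
  have hs := Rat.num_nonneg.2 s.2.1
  omega

theorem UnitRat.exists_code_eq_iff {n : ℕ} : (∃ r : UnitRat, r.code = n) ↔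
    1 ≤ n.unpair.2 ∧ n.unpair.1 ≤ n.unpair.2 ∧ Nat.Coprime n.unpair.1 n.unpair.2 := by
  constructor
  · rintro ⟨r, rfl⟩
    have hnonneg := Rat.num_nonneg.2 r.2.1
    have hle := Rat.num_le_denom_iff.2 r.2.2
    simp only [UnitRat.code, Nat.unpair_pair]
    exact ⟨r.1.den_pos, by omega, r.1.reduced⟩
  · rintro ⟨hpos, hle, hcop⟩
    refine ⟨⟨⟨n.unpair.1, n.unpair.2, by omega, by simpa using hcop⟩, ?_, ?_⟩, ?_⟩
    · exact Rat.num_nonneg.1 (by simp)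
    · exact Rat.num_le_denom_iff.1 (by simpa using hle)
    · simp [UnitRat.code]

theorem coprime_iff_all_range {m n : ℕ} (hn : 1 ≤ n) : Nat.Coprime m n ↔
    ((List.range (n + 1)).all fun d => !(m % d == 0 && n % d == 0) || d == 1) = true := by
  simp only [List.all_eq_true, List.mem_range, Nat.lt_succ_iff, Bool.or_eq_true, Bool.not_eq_true',
    Bool.and_eq_false_iff, beq_eq_false_iff_ne, beq_iff_eq, ← Nat.dvd_iff_mod_eq_zero, ne_eq]
  constructor
  · intro h d _
    by_cases hm : d ∣ m
    · by_cases hd : d ∣ n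
      · exact .inr (Nat.eq_one_of_dvd_coprimes h hm hd)
      · exact .inl (.inr hd)
    · exact .inl (.inl hm)
  · intro h
    have := h _ (Nat.gcd_le_right m hn)
    simpa [Nat.gcd_dvd_left, Nat.gcd_dvd_right] using this

instance : GodelNumbering UnitRat where
  default := ⟨0, le_rfl, zero_le_one⟩
  code := UnitRat.code
  code_injective := UnitRat.code_injective
  computablePred_code := by
    refine computablePred_iff_exists_computable.2 ⟨fun n => Nat.ble 1 n.unpair.2 &&
      n.unpair.1.ble n.unpair.2 && (List.range (n.unpair.2 + 1)).all fun d =>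
        !(n.unpair.1 % d == 0 && n.unpair.2 % d == 0) || d == 1, by fun_prop,
      fun n => ?_⟩
    simp only [UnitRat.exists_code_eq_iff, Bool.and_eq_true, Nat.ble_eq, and_assoc]
    exact and_congr_right fun hpos => and_congr_right fun _ => (coprime_iff_all_range hpos).symm

@[fun_prop] theorem computable_unitRat_code {α : Type*} [Primcodable α] {r : α → UnitRat}
    (hr : Effective r) : Computable fun a => (r a).code := hr

end UnitRat

section Recursion

variable {α σ : Type*} [Primcodable α] [Primcodable σ]

theorem lt_encode_of_mem {m : ℕ} {l : List ℕ} (h : m ∈ l) : m < Encodable.encode l := by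
  induction l with
  | nil => simp at h
  | cons a l ih =>
    rw [Encodable.encode_list_cons, Nat.lt_succ_iff]
    rcases List.mem_cons.1 h with rfl | h
    · exact Nat.left_le_pair _ _
    · exact (ih h).le.trans (Nat.right_le_pair _ _)

theorem exists_computable_termRec {v c : α → ℕ → σ} {g : α → ℕ → ℕ → List σ → σ}
    (hv : Computable fun p : α × ℕ => v p.1 p.2) (hc : Computable fun p : α × ℕ => c p.1 p.2)
    (hg : Computable fun p : α × ℕ × ℕ × List σ => g p.1 p.2.1 p.2.2.1 p.2.2.2) :
    ∃ f : α → ℕ → σ, (Computable fun p : α × ℕ => f p.1 p.2) ∧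
      (∀ a y, f a (Nat.pair 0 y) = v a y) ∧ (∀ a y, f a (Nat.pair 1 y) = c a y) ∧
      ∀ a k m (l : List ℕ), f a (Nat.pair (k + 2) (Nat.pair m (Encodable.encode l))) =
        g a k m (l.map (f a)) := by
  let step : α → ℕ → List σ → σ := fun a n hist =>
    bif n.unpair.1 == 0 then v a n.unpair.2 else
    bif n.unpair.1 == 1 then c a n.unpair.2 else
      g a (n.unpair.1 - 2) n.unpair.2.unpair.1
        ((Denumerable.ofNat (List ℕ) n.unpair.2.unpair.2).map fun m => hist[m]?.getD (v a 0))
  have hstep : Computable fun p : α × List σ => step p.1 p.2.length p.2 := by fun_prop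
  obtain ⟨f, hf, hrec⟩ := exists_computable_strongRec
    (g := fun a hist => step a hist.length hist) hstep
  refine ⟨f, hf, fun a y => ?_, fun a y => ?_, fun a k m l => ?_⟩
  · rw [hrec]; simp [step]
  · rw [hrec]; simp [step]
  · rw [hrec]
    have : ∀ i ∈ l, i < Nat.pair (k + 2) (Nat.pair m (Encodable.encode l)) := fun i hi =>
      lt_natPair_of_le (by omega) ((lt_encode_of_mem hi).le.trans (Nat.right_le_pair _ _))
    have hist : l.map (fun i => ((List.range (Nat.pair (k + 2) (Nat.pair m
        (Encodable.encode l)))).map (f a))[i]?.getD (v a 0)) = l.map (f a) :=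
      List.map_congr_left fun i hi => by simp [this i hi]
    simpa [step] using congrArg (g a k m) hist

theorem exists_computable_formulaRec {b : α → ℕ → ℕ → σ} {i : α → σ → σ → σ}
    {q : α → ℕ → ℕ → ℕ → σ → σ} (hb : Computable fun p : α × ℕ × ℕ => b p.1 p.2.1 p.2.2)
    (hi : Computable fun p : α × σ × σ => i p.1 p.2.1 p.2.2)
    (hq : Computable fun p : α × ℕ × ℕ × ℕ × σ => q p.1 p.2.1 p.2.2.1 p.2.2.2.1 p.2.2.2.2) :
    ∃ f : α → ℕ → σ, (Computable fun p : α × ℕ => f p.1 p.2) ∧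
      (∀ a, ∀ k < 3, ∀ m, f a (Nat.pair k m) = b a k m) ∧
      (∀ a m n, f a (Nat.pair 3 (Nat.pair m n)) = i a (f a m) (f a n)) ∧
      ∀ a k y m, f a (Nat.pair (k + 4) (Nat.pair y m)) = q a k y m (f a m) := by
  let val : α → List σ → ℕ → σ := fun a hist m => hist[m]?.getD (b a 0 0)
  let step : α → ℕ → List σ → σ := fun a n hist =>
    bif n.unpair.1.ble 2 then b a n.unpair.1 n.unpair.2 else
    bif n.unpair.1 == 3 then
      i a (val a hist n.unpair.2.unpair.1) (val a hist n.unpair.2.unpair.2)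
    else q a (n.unpair.1 - 4) n.unpair.2.unpair.1 n.unpair.2.unpair.2
      (val a hist n.unpair.2.unpair.2)
  have hstep : Computable fun p : α × List σ => step p.1 p.2.length p.2 := by fun_prop
  obtain ⟨f, hf, hrec⟩ := exists_computable_strongRec
    (g := fun a hist => step a hist.length hist) hstep
  have left_lt : ∀ k m n, m < Nat.pair (k + 3) (Nat.pair m n) := fun k m n =>
    lt_natPair_of_le (by omega) (Nat.left_le_pair m n)
  have right_lt : ∀ k m n, n < Nat.pair (k + 3) (Nat.pair m n) := fun k m n =>
    lt_natPair_of_le (by omega) (Nat.right_le_pair m n)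
  refine ⟨f, hf, fun a k hk m => ?_, fun a m n => ?_, fun a k y m => ?_⟩
  · rw [hrec]
    have : k.ble 2 = true := by simpa using Nat.lt_succ_iff.1 hk
    simp [step, this]
  · rw [hrec]
    have : Nat.ble 3 2 = false := rfl
    simp [step, val, this, left_lt 0, right_lt 0]
  · rw [hrec]
    have : (k + 4).ble 2 = false := by rw [Bool.eq_false_iff, ne_eq, Nat.ble_eq]; omega
    simp [step, val, this, right_lt (k + 1)]

end Recursion

section GodelNumbers

variable {L : Lang}

namespace Term

theorem code_injective : Function.Injective (code : Term L → ℕ) := by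
  intro s
  induction s with
  | var x => intro t h; cases t <;> simp_all [code]
  | const c =>
    intro t h
    cases t with
    | const d => exact congrArg const (Subtype.ext (by simpa [code] using h))
    | _ => simp [code] at h
  | func f a ih =>
    intro t h
    cases t with
    | func g b =>
      simp only [code, Nat.pair_eq_pair, true_and] at h
      obtain rfl : f = g := Subtype.ext h.1
      have hargs := List.ofFn_injective (Encodable.encode_injective h.2)
      exact congrArg _ (funext fun i => ih i (congrFun hargs i))
    | _ => simp [code] at h

theorem exists_ofFn_code_eq {l : List ℕ} {n : ℕ} (hn : l.length = n)
    (h : ∀ m ∈ l, ∃ t : Term L, t.code = m) :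
    ∃ a : Fin n → Term L, (List.ofFn fun i => (a i).code) = l := by
  subst hn
  choose a ha using fun i : Fin l.length => h _ (List.getElem_mem i.2)
  exact ⟨a, by simp only [ha]; exact List.ofFn_getElem⟩

theorem exists_code_eq_pair_one {m : ℕ} :
    (∃ t : Term L, t.code = Nat.pair 1 m) ↔ L.IsConst m := by
  constructor
  · rintro ⟨t, h⟩
    cases t with
    | const c =>
      obtain rfl : c.1 = m := by simpa [code] using h
      exact c.2
    | _ => simp [code] at h
  · exact fun h => ⟨const ⟨m, h⟩, rfl⟩

theorem exists_code_eq_pair_add_two {k m : ℕ} {l : List ℕ} :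
    (∃ t : Term L, t.code = Nat.pair (k + 2) (Nat.pair m (Encodable.encode l))) ↔
      k = 0 ∧ L.IsFunc m ∧ l.length = L.funcArity m ∧ ∀ i ∈ l, ∃ t : Term L, t.code = i := by
  constructor
  · rintro ⟨t, h⟩
    cases t with
    | func f a =>
      simp only [code, Nat.pair_eq_pair, Encodable.encode_inj] at h
      obtain ⟨hk, rfl, rfl⟩ := h
      exact ⟨by omega, f.2, List.length_ofFn, by simp⟩
    | _ => simp [code] at h
  · rintro ⟨rfl, hm, hl, h⟩
    obtain ⟨a, ha⟩ := exists_ofFn_code_eq hl h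
    exact ⟨func ⟨m, hm⟩ a, by simp [code, ha]⟩

theorem computablePred_code (hL : L.ComputablyGiven) :
    ComputablePred fun n => ∃ t : Term L, t.code = n := by
  obtain ⟨isConst, hC, isConst_iff⟩ := computablePred_iff_exists_computable.1 hL.const
  obtain ⟨isFunc, hF, isFunc_iff⟩ := computablePred_iff_exists_computable.1 hL.func
  have hA := hL.funcArity
  obtain ⟨f, hf, f_var, f_const, f_func⟩ := exists_computable_termRec (α := Unit)
    (v := fun _ _ => true) (c := fun _ m => isConst m)
    (g := fun _ k m l => k == 0 && (isFunc m && (l.length == L.funcArity m && l.all fun b => b)))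
    (by fun_prop) (by fun_prop) (by fun_prop)
  refine computablePred_iff_exists_computable.2 ⟨f (), hf.comp (g := fun n => ((), n))
    (by fun_prop), fun n => ?_⟩
  induction n using Nat.strong_induction_on with
  | _ n ih =>
    obtain ⟨k, m, rfl⟩ : ∃ k m, n = Nat.pair k m := ⟨_, _, (Nat.pair_unpair n).symm⟩
    match k with
    | 0 => simpa [f_var] using ⟨var m, rfl⟩
    | 1 => rw [f_const, isConst_iff, exists_code_eq_pair_one]
    | k + 2 =>
      obtain ⟨e, l, rfl⟩ : ∃ e, ∃ l : List ℕ, m = Nat.pair e (Encodable.encode l) :=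
        ⟨m.unpair.1, Denumerable.ofNat _ m.unpair.2, by simp⟩
      have ihl : ∀ i ∈ l, f () i = true ↔ ∃ t : Term L, t.code = i := fun i hi =>
        ih i (lt_natPair_of_le (by omega) ((lt_encode_of_mem hi).le.trans (Nat.right_le_pair _ _)))
      simpa [f_func, exists_code_eq_pair_add_two, isFunc_iff] using fun _ _ _ => forall₂_congr ihl

instance [hL : Fact L.ComputablyGiven] : GodelNumbering (Term L) where
  default := var 0
  code := code
  code_injective := code_injective
  computablePred_code := computablePred_code hL.out

theorem decode_code [Fact L.ComputablyGiven] (t : Term L) : decode (Term L) t.code = t :=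
  RPL.decode_code t

end Term

namespace Formula

theorem code_injective : Function.Injective (code : Formula L → ℕ) := by
  intro φ
  induction φ with
  | rat r => intro ψ h; cases ψ <;> simp_all [code, UnitRat.code_injective.eq_iff]
  | sim s t => intro ψ h; cases ψ <;> simp_all [code, Term.code_injective.eq_iff]
  | rel R a =>
    intro ψ h
    cases ψ with
    | rel S b =>
      simp only [code, Nat.pair_eq_pair, true_and] at h
      obtain rfl : R = S := Subtype.ext h.1
      have hargs := List.ofFn_injective (Encodable.encode_injective h.2)
      exact congrArg _ (funext fun i => Term.code_injective (congrFun hargs i))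
    | _ => simp [code] at h
  | imp φ ψ ihφ ihψ =>
    intro χ h
    cases χ with
    | imp φ' ψ' =>
      simp only [code, Nat.pair_eq_pair, true_and] at h
      rw [ihφ h.1, ihψ h.2]
    | _ => simp [code] at h
  | all y φ ih =>
    intro χ h
    cases χ with
    | all y' φ' =>
      simp only [code, Nat.pair_eq_pair, true_and] at h
      rw [h.1, ih h.2]
    | _ => simp [code] at h

theorem exists_code_eq_pair_zero {m : ℕ} :
    (∃ φ : Formula L, φ.code = Nat.pair 0 m) ↔ ∃ r : UnitRat, r.code = m := by
  constructor
  · rintro ⟨φ, h⟩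
    cases φ with
    | rat r => exact ⟨r, by simpa [code] using h⟩
    | _ => simp [code] at h
  · rintro ⟨r, rfl⟩
    exact ⟨rat r, rfl⟩

theorem exists_code_eq_pair_one {m n : ℕ} : (∃ φ : Formula L, φ.code = Nat.pair 1 (Nat.pair m n)) ↔
    (∃ s : Term L, s.code = m) ∧ ∃ t : Term L, t.code = n := by
  constructor
  · rintro ⟨φ, h⟩
    cases φ with
    | sim s t =>
      simp only [code, Nat.pair_eq_pair, true_and] at h
      exact ⟨⟨s, h.1⟩, ⟨t, h.2⟩⟩
    | _ => simp [code] at h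
  · rintro ⟨⟨s, rfl⟩, ⟨t, rfl⟩⟩
    exact ⟨sim s t, rfl⟩

theorem exists_code_eq_pair_two {m : ℕ} {l : List ℕ} :
    (∃ φ : Formula L, φ.code = Nat.pair 2 (Nat.pair m (Encodable.encode l))) ↔
      L.IsRel m ∧ l.length = L.relArity m ∧ ∀ i ∈ l, ∃ t : Term L, t.code = i := by
  constructor
  · rintro ⟨φ, h⟩
    cases φ with
    | rel R a =>
      simp only [code, Nat.pair_eq_pair, Encodable.encode_inj, true_and] at h
      obtain ⟨rfl, rfl⟩ := h
      exact ⟨R.2, List.length_ofFn, by simp⟩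
    | _ => simp [code] at h
  · rintro ⟨hm, hl, h⟩
    obtain ⟨a, ha⟩ := Term.exists_ofFn_code_eq hl h
    exact ⟨rel ⟨m, hm⟩ a, by simp [code, ha]⟩

theorem exists_code_eq_pair_three {m n : ℕ} :
    (∃ χ : Formula L, χ.code = Nat.pair 3 (Nat.pair m n)) ↔
      (∃ φ : Formula L, φ.code = m) ∧ ∃ ψ : Formula L, ψ.code = n := by
  constructor
  · rintro ⟨χ, h⟩
    cases χ with
    | imp φ ψ =>
      simp only [code, Nat.pair_eq_pair, true_and] at h
      exact ⟨⟨φ, h.1⟩, ⟨ψ, h.2⟩⟩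
    | _ => simp [code] at h
  · rintro ⟨⟨φ, rfl⟩, ⟨ψ, rfl⟩⟩
    exact ⟨imp φ ψ, rfl⟩

theorem exists_code_eq_pair_add_four {k y m : ℕ} :
    (∃ χ : Formula L, χ.code = Nat.pair (k + 4) (Nat.pair y m)) ↔
      k = 0 ∧ ∃ φ : Formula L, φ.code = m := by
  constructor
  · rintro ⟨χ, h⟩
    cases χ with
    | all z φ =>
      simp only [code, Nat.pair_eq_pair] at h
      exact ⟨by omega, φ, h.2.2⟩
    | _ => simp [code] at h
  · rintro ⟨rfl, ⟨φ, rfl⟩⟩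
    exact ⟨all y φ, rfl⟩

theorem exists_computable_isAtomicCode (hL : L.ComputablyGiven) :
    ∃ d : ℕ → ℕ → Bool, (Computable fun p : ℕ × ℕ => d p.1 p.2) ∧
      ∀ k < 3, ∀ m, d k m = true ↔ ∃ φ : Formula L, φ.code = Nat.pair k m := by
  obtain ⟨isRat, hQ, isRat_iff⟩ := computablePred_iff_exists_computable.1
    (GodelNumbering.computablePred_code (X := UnitRat))
  obtain ⟨isTerm, hT, isTerm_iff⟩ := computablePred_iff_exists_computable.1
    (Term.computablePred_code hL)
  obtain ⟨isRel, hR, isRel_iff⟩ := computablePred_iff_exists_computable.1 hL.rel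
  have hA := hL.relArity
  refine ⟨fun k m =>
    bif k == 0 then isRat m else
    bif k == 1 then isTerm m.unpair.1 && isTerm m.unpair.2 else
      isRel m.unpair.1 &&
        ((Denumerable.ofNat (List ℕ) m.unpair.2).length == L.relArity m.unpair.1 &&
          (Denumerable.ofNat (List ℕ) m.unpair.2).all isTerm), by fun_prop, fun k hk m => ?_⟩
  match k with
  | 0 => exact (isRat_iff m).trans exists_code_eq_pair_zero.symm
  | 1 =>
    obtain ⟨a, b, rfl⟩ : ∃ a b, m = Nat.pair a b := ⟨_, _, (Nat.pair_unpair m).symm⟩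
    simp [exists_code_eq_pair_one, isTerm_iff]
  | 2 =>
    obtain ⟨e, l, rfl⟩ : ∃ e, ∃ l : List ℕ, m = Nat.pair e (Encodable.encode l) :=
      ⟨m.unpair.1, Denumerable.ofNat _ m.unpair.2, by simp⟩
    simp [exists_code_eq_pair_two, isRel_iff, isTerm_iff]

theorem computablePred_code (hL : L.ComputablyGiven) :
    ComputablePred fun n => ∃ φ : Formula L, φ.code = n := by
  obtain ⟨d, hd, d_iff⟩ := exists_computable_isAtomicCode hL
  obtain ⟨f, hf, f_atomic, f_imp, f_all⟩ := exists_computable_formulaRec (α := Unit)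
    (b := fun _ => d) (i := fun _ a b => a && b) (q := fun _ k _ _ b => k == 0 && b)
    (by fun_prop) (by fun_prop) (by fun_prop)
  refine computablePred_iff_exists_computable.2 ⟨f (), hf.comp (g := fun n => ((), n))
    (by fun_prop), fun n => ?_⟩
  induction n using Nat.strong_induction_on with
  | _ n ih =>
    obtain ⟨k, m, rfl⟩ : ∃ k m, n = Nat.pair k m := ⟨_, _, (Nat.pair_unpair n).symm⟩
    rcases lt_or_ge k 3 with hk | hk
    · rw [f_atomic _ k hk, d_iff k hk]
    obtain ⟨k, rfl⟩ := Nat.exists_eq_add_of_le' hk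
    obtain ⟨a, b, rfl⟩ : ∃ a b, m = Nat.pair a b := ⟨_, _, (Nat.pair_unpair m).symm⟩
    have iha := ih a (lt_natPair_of_le (by omega) (Nat.left_le_pair a b))
    have ihb := ih b (lt_natPair_of_le (by omega) (Nat.right_le_pair a b))
    match k with
    | 0 => simp [f_imp, exists_code_eq_pair_three, iha, ihb]
    | k + 1 => simp [f_all _ k, exists_code_eq_pair_add_four, ihb]

instance [hL : Fact L.ComputablyGiven] : GodelNumbering (Formula L) where
  default := bot
  code := code
  code_injective := code_injective
  computablePred_code := computablePred_code hL.out

theorem decode_code [Fact L.ComputablyGiven] (φ : Formula L) : decode (Formula L) φ.code = φ :=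
  RPL.decode_code φ

end Formula

end GodelNumbers

section EffectiveSyntax

variable {L : Lang} {α σ : Type*} [Primcodable α] [Primcodable σ]

namespace Term

/-- The list of the variables that occur in a term. -/
def vars : Term L → List ℕ
  | var y => [y]
  | const _ => []
  | func _ a => (List.ofFn fun i => (a i).vars).flatten

theorem mem_vars {x : ℕ} {t : Term L} : x ∈ t.vars ↔ t.Occurs x := by
  induction t with
  | var y => simp [vars, Occurs, eq_comm]
  | const c => simp [vars, Occurs]
  | func f a ih => simp [vars, Occurs, List.mem_flatten, ih]

variable [Fact L.ComputablyGiven]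

theorem computable_of_rec {F : α → Term L → σ} {v c : α → ℕ → σ} {g : α → ℕ → List σ → σ}
    (hv : Computable fun p : α × ℕ => v p.1 p.2) (hc : Computable fun p : α × ℕ => c p.1 p.2)
    (hg : Computable fun p : α × ℕ × List σ => g p.1 p.2.1 p.2.2)
    (F_var : ∀ a y, F a (var y) = v a y) (F_const : ∀ a k, F a (const k) = c a k.1)
    (F_func : ∀ a f args, F a (func f args) = g a f.1 (List.ofFn fun i => F a (args i)))
    {t : α → Term L} (ht : Effective t) : Computable fun a => F a (t a) := by
  have hg' : Computable fun p : α × ℕ × ℕ × List σ => g p.1 p.2.2.1 p.2.2.2 :=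
    hg.comp (g := fun p : α × ℕ × ℕ × List σ => (p.1, p.2.2.1, p.2.2.2)) (by fun_prop)
  obtain ⟨h, hh, h_var, h_const, h_func⟩ := exists_computable_termRec
    (g := fun a _ m l => g a m l) hv hc hg'
  have h_code : ∀ a (t : Term L), h a t.code = F a t := by
    intro a t
    induction t with
    | var y => rw [code, h_var, F_var]
    | const k => rw [code, h_const, F_const]
    | func e args ih =>
      rw [code, h_func a 0, F_func, List.map_ofFn]
      exact congrArg (fun args' => g a e.1 (List.ofFn args')) (funext ih)
  exact (hh.comp (computable_id.pair ht)).of_eq fun a => h_code a _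

@[fun_prop] theorem computable_code {t : α → Term L} (ht : Effective t) :
    Computable fun a => (t a).code := ht

@[fun_prop] theorem effective_var {y : α → ℕ} (hy : Computable y) :
    Effective fun a => (var (y a) : Term L) :=
  computable_natPair (computable_const 0) hy

@[fun_prop] theorem computable_vars {t : α → Term L} (ht : Effective t) :
    Computable fun a => (t a).vars :=
  computable_of_rec (F := fun _ => vars) (v := fun _ y => [y]) (c := fun _ _ => [])
    (g := fun _ _ l => l.flatMap fun m => m) (by fun_prop) (by fun_prop) (by fun_prop)
    (fun _ _ => rfl) (fun _ _ => rfl) (fun _ _ _ => by simp [vars]) ht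

@[fun_prop] theorem effective_subst {x : α → ℕ} {s t : α → Term L} (hx : Computable x)
    (hs : Effective s) (ht : Effective t) : Effective fun a => subst (x a) (s a) (t a) :=
  computable_of_rec (F := fun a t => (subst (x a) (s a) t).code)
    (v := fun a y => bif y == x a then (s a).code else Nat.pair 0 y)
    (c := fun _ k => Nat.pair 1 k)
    (g := fun _ e l => Nat.pair 2 (Nat.pair e (Encodable.encode l)))
    (by fun_prop) (by fun_prop) (by fun_prop)
    (fun a y => by simp only [subst, Bool.cond_eq_ite, beq_iff_eq]; split_ifs <;> rfl)
    (fun _ _ => rfl) (fun _ _ _ => rfl) ht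

theorem computablePred_closed :
    ComputablePred fun n => ∃ t : ClosedTerm L, t.1.code = n := by
  refine computablePred_iff_exists_computable.2 ⟨fun n =>
    (decode (Term L) n).code == n && (decode (Term L) n).vars.length == 0, by fun_prop,
    fun n => ?_⟩
  simp only [Bool.and_eq_true, beq_iff_eq, List.length_eq_zero_iff,
    List.eq_nil_iff_forall_not_mem, mem_vars]
  constructor
  · exact fun h => ⟨⟨_, h.2⟩, h.1⟩
  · rintro ⟨t, rfl⟩
    rw [decode_code]
    exact ⟨rfl, t.2⟩

end Term

namespace Formula

/-- The list of the free variables of a formula. -/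
def freeVars : Formula L → List ℕ
  | rat _ => []
  | sim s t => s.vars ++ t.vars
  | rel _ a => (List.ofFn fun i => (a i).vars).flatten
  | imp φ ψ => φ.freeVars ++ ψ.freeVars
  | all y φ => φ.freeVars.filter fun x => !(y == x)

theorem mem_freeVars {x : ℕ} {φ : Formula L} : x ∈ φ.freeVars ↔ φ.Free x := by
  induction φ with
  | rat r => simp [freeVars, Free]
  | sim s t => simp [freeVars, Free, Term.mem_vars]
  | rel R a => simp [freeVars, Free, List.mem_flatten, Term.mem_vars]
  | imp φ ψ ihφ ihψ => simp [freeVars, Free, ihφ, ihψ]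
  | all y φ ih => simp [freeVars, Free, ih, and_comm]

variable [Fact L.ComputablyGiven]

theorem computable_of_rec {F : α → Formula L → σ} {q : α → ℕ → σ} {s : α → ℕ → ℕ → σ}
    {r : α → ℕ → List ℕ → σ} {i : α → σ → σ → σ} {u : α → ℕ → ℕ → σ → σ}
    (hq : Computable fun p : α × ℕ => q p.1 p.2)
    (hs : Computable fun p : α × ℕ × ℕ => s p.1 p.2.1 p.2.2)
    (hr : Computable fun p : α × ℕ × List ℕ => r p.1 p.2.1 p.2.2)
    (hi : Computable fun p : α × σ × σ => i p.1 p.2.1 p.2.2)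
    (hu : Computable fun p : α × ℕ × ℕ × σ => u p.1 p.2.1 p.2.2.1 p.2.2.2)
    (F_rat : ∀ a c, F a (rat c) = q a c.code)
    (F_sim : ∀ a t t', F a (sim t t') = s a t.code t'.code)
    (F_rel : ∀ a R args, F a (rel R args) = r a R.1 (List.ofFn fun i => (args i).code))
    (F_imp : ∀ a φ ψ, F a (imp φ ψ) = i a (F a φ) (F a ψ))
    (F_all : ∀ a y φ, F a (all y φ) = u a y φ.code (F a φ))
    {φ : α → Formula L} (hφ : Effective φ) : Computable fun a => F a (φ a) := by
  let b : α → ℕ → ℕ → σ := fun a k m =>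
    bif k == 0 then q a m else bif k == 1 then s a m.unpair.1 m.unpair.2 else
      r a m.unpair.1 (Denumerable.ofNat (List ℕ) m.unpair.2)
  have hb : Computable fun p : α × ℕ × ℕ => b p.1 p.2.1 p.2.2 := by fun_prop
  have hu' : Computable fun p : α × ℕ × ℕ × ℕ × σ => u p.1 p.2.2.1 p.2.2.2.1 p.2.2.2.2 :=
    hu.comp (g := fun p : α × ℕ × ℕ × ℕ × σ => (p.1, p.2.2.1, p.2.2.2.1, p.2.2.2.2))
      (by fun_prop)
  obtain ⟨h, hh, h_atomic, h_imp, h_all⟩ := exists_computable_formulaRec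
    (q := fun a _ y m x => u a y m x) hb hi hu'
  have h_code : ∀ a (φ : Formula L), h a φ.code = F a φ := by
    intro a φ
    induction φ with
    | rat c => simp [code, h_atomic, b, F_rat]
    | sim t t' => simp [code, h_atomic, b, F_sim]
    | rel R args => simp [code, h_atomic, b, F_rel]
    | imp φ ψ ihφ ihψ => rw [code, h_imp, F_imp, ihφ, ihψ]
    | all y φ ih => rw [code, h_all a 0, F_all, ih]
  exact (hh.comp (computable_id.pair hφ)).of_eq fun a => h_code a _

@[fun_prop] theorem computable_code {φ : α → Formula L} (hφ : Effective φ) :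
    Computable fun a => (φ a).code := hφ

@[fun_prop] theorem effective_rat {r : α → UnitRat} (hr : Effective r) :
    Effective fun a => (rat (r a) : Formula L) :=
  computable_natPair (computable_const 0) hr

@[fun_prop] theorem effective_sim {s t : α → Term L} (hs : Effective s) (ht : Effective t) :
    Effective fun a => sim (s a) (t a) :=
  computable_natPair (computable_const 1) (computable_natPair hs ht)

@[fun_prop] theorem effective_imp {φ ψ : α → Formula L} (hφ : Effective φ) (hψ : Effective ψ) :
    Effective fun a => imp (φ a) (ψ a) :=
  computable_natPair (computable_const 3) (computable_natPair hφ hψ)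

@[fun_prop] theorem effective_all {y : α → ℕ} {φ : α → Formula L} (hy : Computable y)
    (hφ : Effective φ) : Effective fun a => all (y a) (φ a) :=
  computable_natPair (computable_const 4) (computable_natPair hy hφ)

@[fun_prop] theorem effective_neg {φ : α → Formula L} (hφ : Effective φ) :
    Effective fun a => neg (φ a) :=
  effective_imp hφ (effective_const bot)

@[fun_prop] theorem effective_oplus {φ ψ : α → Formula L} (hφ : Effective φ) (hψ : Effective ψ) :
    Effective fun a => oplus (φ a) (ψ a) :=
  effective_neg (effective_imp hφ (effective_neg hψ))

@[fun_prop] theorem effective_iff {φ ψ : α → Formula L} (hφ : Effective φ) (hψ : Effective ψ) :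
    Effective fun a => iff (φ a) (ψ a) :=
  effective_oplus (effective_imp hφ hψ) (effective_imp hψ hφ)

@[fun_prop] theorem computable_freeVars {φ : α → Formula L} (hφ : Effective φ) :
    Computable fun a => (φ a).freeVars :=
  computable_of_rec (F := fun _ => freeVars) (q := fun _ _ => [])
    (s := fun _ m n => (decode (Term L) m).vars ++ (decode (Term L) n).vars)
    (r := fun _ _ l => l.flatMap fun m => (decode (Term L) m).vars)
    (i := fun _ l l' => l ++ l') (u := fun _ y _ l => l.filter fun x => !(y == x))
    (by fun_prop) (by fun_prop) (by fun_prop) (by fun_prop) (by fun_prop) (fun _ _ => rfl)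
    (fun _ s t => by rw [freeVars, Term.decode_code, Term.decode_code])
    (fun _ R args => by
      simp [freeVars, Term.decode_code, List.flatMap_def, List.map_ofFn, Function.comp_def])
    (fun _ _ _ => rfl) (fun _ _ _ => rfl) hφ

@[fun_prop] theorem effective_subst {x : α → ℕ} {s : α → Term L} {φ : α → Formula L}
    (hx : Computable x) (hs : Effective s) (hφ : Effective φ) :
    Effective fun a => (φ a).subst (x a) (s a) :=
  computable_of_rec (F := fun a φ => (φ.subst (x a) (s a)).code) (q := fun _ m => Nat.pair 0 m)
    (s := fun a m n => Nat.pair 1 (Nat.pair (Term.subst (x a) (s a) (decode (Term L) m)).code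
      (Term.subst (x a) (s a) (decode (Term L) n)).code))
    (r := fun a R l => Nat.pair 2 (Nat.pair R (Encodable.encode
      (l.map fun m => (Term.subst (x a) (s a) (decode (Term L) m)).code))))
    (i := fun _ m n => Nat.pair 3 (Nat.pair m n))
    (u := fun a y m n => Nat.pair 4 (Nat.pair y (bif y == x a then m else n)))
    (by fun_prop) (by fun_prop) (by fun_prop) (by fun_prop) (by fun_prop) (fun _ _ => rfl)
    (fun _ _ _ => by simp only [subst, code, Term.decode_code])
    (fun _ _ _ => by
      simp only [subst, code, Term.decode_code, List.map_ofFn, Function.comp_def])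
    (fun _ _ _ => rfl)
    (fun a y _ => by simp only [subst, Bool.cond_eq_ite, beq_iff_eq]; split_ifs <;> rfl) hφ

theorem computablePred_freeFor {x : α → ℕ} {s : α → Term L} {φ : α → Formula L}
    (hx : Computable x) (hs : Effective s) (hφ : Effective φ) :
    ComputablePred fun a => (φ a).FreeFor (s a) (x a) := by
  classical
  refine computablePred_iff_exists_computable.2 ⟨_, ?_, fun a => decide_eq_true_iff⟩
  exact computable_of_rec (F := fun a φ => decide (φ.FreeFor (s a) (x a))) (q := fun _ _ => true)
    (s := fun _ _ _ => true) (r := fun _ _ _ => true) (i := fun _ b c => b && c)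
    (u := fun a y m b => !(!(y == x a) && (decode (Formula L) m).freeVars.elem (x a)) ||
      (!(s a).vars.elem y && b))
    (by fun_prop) (by fun_prop) (by fun_prop) (by fun_prop) (by fun_prop)
    (fun _ _ => decide_eq_true trivial) (fun _ _ _ => decide_eq_true trivial)
    (fun _ _ _ => decide_eq_true trivial)
    (fun _ _ _ => by rw [Bool.eq_iff_iff, decide_eq_true_iff]; simp [FreeFor])
    (fun a y ψ => by
      rw [Bool.eq_iff_iff]
      simp [FreeFor, decode_code, mem_freeVars, Term.mem_vars]) hφ

theorem computablePred_not_free {x : α → ℕ} {φ : α → Formula L} (hx : Computable x)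
    (hφ : Effective φ) : ComputablePred fun a => ¬ (φ a).Free (x a) :=
  computablePred_iff_exists_computable.2 ⟨fun a => !(φ a).freeVars.elem (x a), by fun_prop,
    fun a => by simp [mem_freeVars]⟩

end Formula

end EffectiveSyntax

section ProvabilityEnumeration

section Effective

variable {α X : Type*} [Primcodable α] [GodelNumbering X]

theorem rePred_effective_eq {f g : α → X} (hf : Effective f) (hg : Effective g) :
    REPred fun a => f a = g a :=
  (rePred_eq hf hg).of_eq fun _ => GodelNumbering.code_injective.eq_iff

theorem rePred_effective_comp {p : X → Prop}
    (hp : REPred fun n => ∃ x, p x ∧ GodelNumbering.code x = n) {f : α → X} (hf : Effective f) :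
    REPred fun a => p (f a) :=
  (rePred_comp hp hf).of_eq fun _ =>
    ⟨fun ⟨_, hx, h⟩ => GodelNumbering.code_injective h ▸ hx, fun h => ⟨_, h, rfl⟩⟩

end Effective

namespace UnitRat

theorem val_mul_den (r : UnitRat) : r.1 * r.1.den = (r.1.num.natAbs : ℚ) := by
  rw [Rat.mul_den_eq_num, Nat.cast_natAbs, abs_of_nonneg (Rat.num_nonneg.2 r.2.1)]

theorem eq_tsub_iff {r s t : UnitRat} : t = s.tsub r ↔
    t.1.num.natAbs * (r.1.den * s.1.den) =
      t.1.den * (s.1.num.natAbs * r.1.den - r.1.num.natAbs * s.1.den) := by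
  have sub_eq : ((s.1.num.natAbs * r.1.den - r.1.num.natAbs * s.1.den : ℕ) : ℚ) =
      (s.tsub r).1 * (r.1.den * s.1.den) := by
    rw [Nat.sub_eq_max_sub, Nat.cast_sub (le_max_right _ _), Nat.cast_max]
    push_cast [← val_mul_den]
    rw [tsub, max_mul_of_nonneg _ _ (by positivity), ← max_sub_sub_right]
    ring_nf
  rw [Subtype.ext_iff, ← Nat.cast_inj (R := ℚ), Nat.cast_mul, Nat.cast_mul t.1.den, sub_eq,
    ← val_mul_den, Nat.cast_mul, mul_right_comm, mul_comm, ← mul_assoc]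
  have hr : (r.1.den : ℚ) ≠ 0 := Nat.cast_ne_zero.2 r.1.den_nz
  have hs : (s.1.den : ℚ) ≠ 0 := Nat.cast_ne_zero.2 s.1.den_nz
  have ht : (t.1.den : ℚ) ≠ 0 := Nat.cast_ne_zero.2 t.1.den_nz
  constructor
  · rintro h
    rw [← h]; ring
  · intro h
    apply mul_left_cancel₀ (mul_ne_zero (mul_ne_zero hr hs) ht)
    linear_combination h

theorem rePred_eq_tsub {α : Type*} [Primcodable α] {r s t : α → UnitRat} (hr : Effective r)
    (hs : Effective s) (ht : Effective t) : REPred fun a => t a = (s a).tsub (r a) := by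
  have hcode : REPred fun a => (t a).code.unpair.1 * ((r a).code.unpair.2 * (s a).code.unpair.2) =
      (t a).code.unpair.2 * ((s a).code.unpair.1 * (r a).code.unpair.2 -
        (r a).code.unpair.1 * (s a).code.unpair.2) :=
    rePred_eq (by fun_prop) (by fun_prop)
  exact hcode.of_eq fun a => by simp only [code, Nat.unpair_pair, eq_tsub_iff]

end UnitRat

open Formula

variable {L : Lang} {α : Type*} [Primcodable α]

/-- The instances of the logical axiom schemas of `RPL∀`. -/
def LogicalAxiom (χ : Formula L) : Prop :=
  (∃ φ ψ, χ = imp φ (imp ψ φ)) ∨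
  (∃ φ ψ σ, χ = imp (imp φ ψ) (imp (imp ψ σ) (imp φ σ))) ∨
  (∃ φ ψ, χ = imp (imp (imp φ ψ) ψ) (imp (imp ψ φ) φ)) ∨
  (∃ φ ψ, χ = imp (imp (neg φ) (neg ψ)) (imp ψ φ)) ∨
  (∃ x φ t, FreeFor t x φ ∧ χ = imp (all x φ) (φ.subst x t)) ∨
  (∃ x φ ψ, ¬ φ.Free x ∧ χ = imp (all x (imp φ ψ)) (imp φ (all x ψ))) ∨
  (∃ r s t : UnitRat, t = s.tsub r ∧ χ = iff (imp (rat r) (rat s)) (rat t)) ∨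
  (∃ x, χ = sim (.var x) (.var x)) ∨
  (∃ x y, χ = imp (sim (.var x) (.var y)) (sim (.var y) (.var x))) ∨
  ∃ x y z, χ = imp (oplus (sim (.var x) (.var y)) (sim (.var y) (.var z)))
    (sim (.var x) (.var z))

theorem LogicalAxiom.provable {T : Set (Formula L)} {χ : Formula L} (h : LogicalAxiom χ) :
    Provable T χ := by
  rcases h with ⟨φ, ψ, rfl⟩ | ⟨φ, ψ, σ, rfl⟩ | ⟨φ, ψ, rfl⟩ | ⟨φ, ψ, rfl⟩ | ⟨x, φ, t, h, rfl⟩ |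
    ⟨x, φ, ψ, h, rfl⟩ | ⟨r, s, _, rfl, rfl⟩ | ⟨x, rfl⟩ | ⟨x, y, rfl⟩ | ⟨x, y, z, rfl⟩
  exacts [.l1 φ ψ, .l2 φ ψ σ, .l3 φ ψ, .l4 φ ψ, .all1 x φ t h, .all2 x φ ψ h, .book r s, .refl x,
    .symm x y, .trans x y z]

/-- Modus ponens (`k = 0`) and generalization over the variable `k - 1`, on Gödel numbers. -/
def inferenceRule (k m n : ℕ) : Option ℕ :=
  bif k == 0 then
    bif n == Nat.pair 3 (Nat.pair m n.unpair.2.unpair.2) then some n.unpair.2.unpair.2 else none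
  else some (Nat.pair 4 (Nat.pair (k - 1) m))

theorem computable_inferenceRule :
    Computable fun p : ℕ × ℕ × ℕ => inferenceRule p.1 p.2.1 p.2.2 := by
  unfold inferenceRule
  fun_prop

theorem inferenceRule_imp (φ ψ : Formula L) :
    inferenceRule 0 φ.code (imp φ ψ).code = some ψ.code := by
  simp [inferenceRule, code]

theorem inferenceRule_all (x : ℕ) (φ : Formula L) (n : ℕ) :
    inferenceRule (x + 1) φ.code n = some (all x φ).code := by
  simp [inferenceRule, code]

theorem Provable.exists_of_inferenceRule {T : Set (Formula L)} {φ ψ : Formula L} {k n : ℕ}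
    (hφ : Provable T φ) (hψ : Provable T ψ) (h : inferenceRule k φ.code ψ.code = some n) :
    ∃ χ, Provable T χ ∧ χ.code = n := by
  cases k with
  | succ x =>
    rw [inferenceRule_all, Option.some_inj] at h
    exact ⟨_, hφ.gen x, h⟩
  | zero =>
    cases hψφ : ψ.code == Nat.pair 3 (Nat.pair φ.code ψ.code.unpair.2.unpair.2) with
    | false => simp [inferenceRule, hψφ] at h
    | true =>
      simp only [inferenceRule, beq_self_eq_true, cond_true, hψφ, Option.some_inj] at h
      rw [h, beq_iff_eq] at hψφ
      cases ψ with
      | imp φ' χ =>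
        obtain ⟨hφ', hχ⟩ := Nat.pair_eq_pair.1 (Nat.pair_eq_pair.1 hψφ).2
        obtain rfl := code_injective hφ'
        exact ⟨χ, hφ.mp hψ, hχ⟩
      | _ => simp [code] at hψφ

theorem ruleClosure_iff_provable {T : Set (Formula L)} {n : ℕ} :
    RuleClosure (fun n => ∃ φ : Formula L, (φ ∈ T ∨ LogicalAxiom φ) ∧ φ.code = n) inferenceRule n ↔
      ∃ φ, Provable T φ ∧ φ.code = n := by
  constructor
  · intro h
    induction h with
    | base h =>
      obtain ⟨φ, hφ, rfl⟩ := h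
      exact ⟨φ, hφ.elim .ax LogicalAxiom.provable, rfl⟩
    | step _ _ hrule ihφ ihψ =>
      obtain ⟨φ, hφ, rfl⟩ := ihφ
      obtain ⟨ψ, hψ, rfl⟩ := ihψ
      exact hφ.exists_of_inferenceRule hψ hrule
  · rintro ⟨φ, h, rfl⟩
    induction h with
    | ax h => exact .base ⟨_, .inl h, rfl⟩
    | mp _ _ ihφ ihψ => exact .step ihφ ihψ (inferenceRule_imp _ _)
    | gen x _ ih => exact .step ih ih (inferenceRule_all x _ _)
    | _ =>
      refine .base ⟨_, .inr ?_, rfl⟩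
      grind [LogicalAxiom, neg]

variable [Fact L.ComputablyGiven]

theorem rePred_logicalAxiom {χ : α → Formula L} (hχ : Effective χ) :
    REPred fun a => LogicalAxiom (χ a) := by
  refine rePred_or ?l1 <| rePred_or ?l2 <| rePred_or ?l3 <| rePred_or ?l4 <| rePred_or ?all1 <|
    rePred_or ?all2 <| rePred_or ?book <| rePred_or ?refl <| rePred_or ?symm ?trans
  case l1 | l3 | l4 =>
    exact rePred_exists_decode <| rePred_exists_decode <| rePred_effective_eq (by fun_prop)
      (by fun_prop)
  case l2 =>
    exact rePred_exists_decode <| rePred_exists_decode <| rePred_exists_decode <|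
      rePred_effective_eq (by fun_prop) (by fun_prop)
  case all1 =>
    exact rePred_exists <| rePred_exists_decode <| rePred_exists_decode <|
      rePred_and (computablePred_freeFor (by fun_prop) (by fun_prop) (by fun_prop)).to_re <|
        rePred_effective_eq (by fun_prop) (by fun_prop)
  case all2 =>
    exact rePred_exists <| rePred_exists_decode <| rePred_exists_decode <|
      rePred_and (computablePred_not_free (by fun_prop) (by fun_prop)).to_re <|
        rePred_effective_eq (by fun_prop) (by fun_prop)
  case book =>
    exact rePred_exists_decode <| rePred_exists_decode <| rePred_exists_decode <|
      rePred_and (UnitRat.rePred_eq_tsub (by fun_prop) (by fun_prop) (by fun_prop)) <|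
        rePred_effective_eq (by fun_prop) (by fun_prop)
  case refl => exact rePred_exists <| rePred_effective_eq (by fun_prop) (by fun_prop)
  case symm =>
    exact rePred_exists <| rePred_exists <| rePred_effective_eq (by fun_prop) (by fun_prop)
  case trans =>
    exact rePred_exists <| rePred_exists <| rePred_exists <|
      rePred_effective_eq (by fun_prop) (by fun_prop)

theorem rePred_provable {T : Set (Formula L)} (hT : ComputablyAxiomatizable T)
    {φ : α → Formula L} (hφ : Effective φ) : REPred fun a => Provable T (φ a) := by
  refine rePred_effective_comp ?_ hφ
  refine REPred.of_eq (rePred_ruleClosure ?_ computable_inferenceRule) fun n =>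
    ruleClosure_iff_provable (T := T)
  refine rePred_exists_decode <| rePred_and (rePred_or ?_ ?_) <|
    rePred_eq (by fun_prop) (by fun_prop)
  · exact rePred_effective_comp hT (by fun_prop)
  · exact rePred_logicalAxiom (by fun_prop)

end ProvabilityEnumeration

section Logic

variable {L : Lang} {T : Set (Formula L)}

open Formula

namespace Provable

variable {φ ψ χ : Formula L}

theorem imp_trans (hφψ : Provable T (imp φ ψ)) (hψχ : Provable T (imp ψ χ)) :
    Provable T (imp φ χ) :=
  .mp hψχ (.mp hφψ (.l2 φ ψ χ))

theorem imp_intro (ψ : Formula L) (h : Provable T φ) : Provable T (imp ψ φ) :=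
  .mp h (.l1 φ ψ)

theorem imp_imp_imp_self (φ ψ : Formula L) : Provable T (imp φ (imp (imp φ ψ) ψ)) :=
  (l1 φ (imp ψ φ)).imp_trans (.l3 ψ φ)

theorem imp_left (χ : Formula L) (h : Provable T (imp φ ψ)) :
    Provable T (imp (imp ψ χ) (imp φ χ)) :=
  .mp h (.l2 φ ψ χ)

theorem imp_swap (φ ψ χ : Formula L) :
    Provable T (imp (imp φ (imp ψ χ)) (imp ψ (imp φ χ))) :=
  (l2 φ (imp ψ χ) χ).imp_trans ((imp_imp_imp_self ψ χ).imp_left _)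

theorem swap (h : Provable T (imp φ (imp ψ χ))) : Provable T (imp ψ (imp φ χ)) :=
  .mp h (imp_swap φ ψ χ)

theorem imp_self (φ : Formula L) : Provable T (imp φ φ) :=
  .mp (.l1 φ φ) (l1 φ (imp φ (imp φ φ))).swap

theorem imp_right (χ : Formula L) (h : Provable T (imp φ ψ)) :
    Provable T (imp (imp χ φ) (imp χ ψ)) :=
  .mp h (l2 χ φ ψ).swap

theorem bot_imp (φ : Formula L) : Provable T (imp bot φ) :=
  .mp (imp_intro (imp φ bot) (imp_self bot)) (.l4 φ bot)

theorem neg_neg_imp (φ : Formula L) : Provable T (imp (neg (neg φ)) φ) :=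
  .mp (bot_imp φ) (l3 φ bot).swap

theorem oplus_left (h : Provable T (oplus φ ψ)) : Provable T φ :=
  .mp (.mp h (((bot_imp (neg ψ)).imp_right φ).imp_left bot)) (neg_neg_imp φ)

theorem oplus_right (h : Provable T (oplus φ ψ)) : Provable T ψ :=
  .mp (.mp h ((l1 (neg ψ) φ).imp_left bot)) (neg_neg_imp ψ)

theorem oplus_curry (h : Provable T (imp (oplus φ ψ) χ)) : Provable T (imp φ (imp ψ χ)) :=
  have hφ : Provable T (imp φ (imp ψ (oplus φ ψ))) :=
    (imp_self (imp φ (neg ψ))).swap.imp_trans (imp_swap _ _ _)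
  hφ.imp_trans (h.imp_right ψ)

theorem imp_rat_tsub (r s : UnitRat) :
    Provable T (imp (imp (rat r) (rat s)) (rat (s.tsub r))) :=
  (book r s).oplus_left

theorem rat_tsub_imp (r s : UnitRat) :
    Provable T (imp (rat (s.tsub r)) (imp (rat r) (rat s))) :=
  (book r s).oplus_right

theorem rat_zero : Provable T (rat 0) := by
  have tsub_zero : UnitRat.tsub 0 0 = 0 := Subtype.ext (max_eq_right (sub_self _).le)
  simpa only [tsub_zero] using (imp_self _).mp (imp_rat_tsub (T := T) 0 0)

theorem rat_of_le_nsmul {q : UnitRat} (hq : Provable T (rat q)) (n : ℕ) {s : UnitRat}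
    (hs : s.1 ≤ n * q.1) : Provable T (rat s) := by
  induction n generalizing s with
  | zero =>
    obtain rfl : s = 0 := Subtype.ext (le_antisymm (by simpa using hs) s.2.1)
    exact rat_zero
  | succ n ih =>
    have htsub : Provable T (rat (s.tsub q)) :=
      ih (max_le (by push_cast at hs; linarith) (mul_nonneg n.cast_nonneg q.2.1))
    exact .mp hq (.mp htsub (rat_tsub_imp q s))

theorem rat_eq_zero (hT : Consistent T) {q : UnitRat} (hq : Provable T (rat q)) : q.1 = 0 := by
  by_contra hne
  have hpos : 0 < q.1 := lt_of_le_of_ne q.2.1 (Ne.symm hne)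
  obtain ⟨n, hn⟩ := exists_nat_ge (1 / q.1)
  exact hT (hq.rat_of_le_nsmul n ((div_le_iff₀ hpos).1 hn))

theorem le_of_rat_imp_rat (hT : Consistent T) {r s : UnitRat}
    (h : Provable T (imp (rat r) (rat s))) : s ≤ r :=
  have h0 : max (s.1 - r.1) 0 = 0 := rat_eq_zero hT (h.mp (imp_rat_tsub r s))
  Subtype.coe_le_coe.1 (sub_nonpos.1 (max_eq_right_iff.1 h0))

end Provable

namespace Term

/-- A term without variables. -/
def IsClosed (t : Term L) : Prop := ∀ x, ¬ t.Occurs x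

theorem isClosed_const (c : L.Const) : (const c : Term L).IsClosed := fun _ h => h

/-- Simultaneous substitution for the variables of a term. -/
def substAll (σ : ℕ → Term L) : Term L → Term L
  | var y => σ y
  | const c => const c
  | func f a => func f fun i => (a i).substAll σ

theorem subst_self (x : ℕ) (t : Term L) : subst x (var x) t = t := by
  induction t with
  | var y => by_cases h : y = x <;> simp [subst, h]
  | const c => rfl
  | func f a ih => simp [subst, ih]

theorem subst_of_not_occurs {x : ℕ} {s t : Term L} (h : ¬ t.Occurs x) : subst x s t = t := by
  induction t with
  | var y => exact if_neg h
  | const c => rfl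
  | func f a ih => exact congrArg (func f) (funext fun i => ih i fun hx => h ⟨i, hx⟩)

theorem substAll_var (t : Term L) : t.substAll var = t := by
  induction t with
  | func f a ih => simp [substAll, ih]
  | _ => rfl

theorem substAll_congr {σ σ' : ℕ → Term L} {t : Term L} (h : ∀ x, t.Occurs x → σ x = σ' x) :
    t.substAll σ = t.substAll σ' := by
  induction t with
  | var y => exact h y rfl
  | const c => rfl
  | func f a ih => exact congrArg (func f) (funext fun i => ih i fun x hx => h x ⟨i, hx⟩)

theorem subst_substAll {σ : ℕ → Term L} {y : ℕ} (h : ∀ z, z ≠ y → ¬ (σ z).Occurs y)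
    (hy : σ y = var y) (s t : Term L) :
    subst y s (t.substAll σ) = t.substAll (Function.update σ y s) := by
  induction t with
  | var z =>
    by_cases hz : z = y
    · subst hz; simp [substAll, hy, subst]
    · simp [substAll, hz, subst_of_not_occurs (h z hz)]
  | const c => rfl
  | func f a ih => simp [substAll, subst, ih]

theorem exists_occurs_of_substAll {σ : ℕ → Term L} {x : ℕ} {t : Term L}
    (h : (t.substAll σ).Occurs x) : ∃ z, t.Occurs z ∧ (σ z).Occurs x := by
  induction t with
  | var y => exact ⟨y, rfl, h⟩
  | const c => exact h.elim
  | func f a ih =>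
    obtain ⟨i, hi⟩ := h
    obtain ⟨z, hz, hz'⟩ := ih i hi
    exact ⟨z, ⟨i, hz⟩, hz'⟩

theorem isClosed_substAll {σ : ℕ → Term L} (hσ : ∀ z, (σ z).IsClosed) (t : Term L) :
    (t.substAll σ).IsClosed := fun _ h =>
  have ⟨_, _, hz⟩ := exists_occurs_of_substAll h
  hσ _ _ hz

end Term

namespace Formula

/-- Simultaneous substitution for the free variables of a formula. Bound variables are not renamed:
what is substituted should be closed. -/
def substAll : (ℕ → Term L) → Formula L → Formula L
  | _, rat r => rat r
  | σ, sim s t => sim (s.substAll σ) (t.substAll σ)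
  | σ, rel R a => rel R fun i => (a i).substAll σ
  | σ, imp φ ψ => imp (φ.substAll σ) (ψ.substAll σ)
  | σ, all y φ => all y (φ.substAll (Function.update σ y (.var y)))

theorem subst_self (x : ℕ) (φ : Formula L) : φ.subst x (.var x) = φ := by
  induction φ with
  | imp φ ψ ihφ ihψ => simp [subst, ihφ, ihψ]
  | all y φ ih => simp [subst, ih]
  | _ => simp [subst, Term.subst_self]

theorem freeFor_self (x : ℕ) (φ : Formula L) : FreeFor (.var x) x φ := by
  induction φ with
  | imp φ ψ ihφ ihψ => exact ⟨ihφ, ihψ⟩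
  | all y φ ih =>
    by_cases hy : y = x
    · exact .inl fun h => h.1 hy
    · exact .inr ⟨fun h => hy h.symm, ih⟩
  | _ => trivial

theorem _root_.RPL.Term.IsClosed.freeFor {t : Term L} (ht : t.IsClosed) (x : ℕ) (φ : Formula L) :
    FreeFor t x φ := by
  induction φ with
  | imp φ ψ ihφ ihψ => exact ⟨ihφ, ihψ⟩
  | all y φ ih => exact .inr ⟨ht y, ih⟩
  | _ => trivial

theorem substAll_var (φ : Formula L) : φ.substAll .var = φ := by
  induction φ with
  | imp φ ψ ihφ ihψ => simp [substAll, ihφ, ihψ]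
  | all y φ ih => simp [substAll, ih]
  | _ => simp [substAll, Term.substAll_var]

theorem substAll_congr {φ : Formula L} {σ σ' : ℕ → Term L} (h : ∀ x, φ.Free x → σ x = σ' x) :
    φ.substAll σ = φ.substAll σ' := by
  induction φ generalizing σ σ' with
  | rat r => rfl
  | sim s t =>
    exact congrArg₂ sim (Term.substAll_congr fun x hx => h x (.inl hx))
      (Term.substAll_congr fun x hx => h x (.inr hx))
  | rel R a =>
    exact congrArg (rel R) (funext fun i => Term.substAll_congr fun x hx => h x ⟨i, hx⟩)
  | imp φ ψ ihφ ihψ =>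
    exact congrArg₂ imp (ihφ fun x hx => h x (.inl hx)) (ihψ fun x hx => h x (.inr hx))
  | all y φ ih =>
    refine congrArg (all y) (ih fun x hx => ?_)
    by_cases hxy : x = y
    · simp [hxy]
    · simp [hxy, h x ⟨Ne.symm hxy, hx⟩]

theorem substAll_of_isSentence {φ : Formula L} (hφ : φ.IsSentence) (σ : ℕ → Term L) :
    φ.substAll σ = φ := by
  rw [substAll_congr fun x hx => absurd hx (hφ x), substAll_var]

theorem subst_substAll {φ : Formula L} {σ : ℕ → Term L} {y : ℕ}
    (h : ∀ z, z ≠ y → ¬ (σ z).Occurs y) (hy : σ y = .var y) (s : Term L) :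
    (φ.substAll σ).subst y s = φ.substAll (Function.update σ y s) := by
  induction φ generalizing σ with
  | rat r => rfl
  | sim t u => simp [substAll, subst, Term.subst_substAll h hy]
  | rel R a => simp [substAll, subst, Term.subst_substAll h hy]
  | imp φ ψ ihφ ihψ => simp [substAll, subst, ihφ h hy, ihψ h hy]
  | all z φ ih =>
    simp only [substAll, subst]
    by_cases hz : z = y
    · subst hz; simp
    · rw [if_neg hz, ih, Function.update_comm hz]
      · intro w hw
        by_cases hwz : w = z
        · subst hwz; simpa [Term.Occurs] using hz
        · simpa [hwz] using h w hw
      · simp [Ne.symm hz, hy]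

theorem exists_free_of_substAll {φ : Formula L} {σ : ℕ → Term L} {x : ℕ}
    (h : (φ.substAll σ).Free x) : ∃ z, φ.Free z ∧ (σ z).Occurs x := by
  induction φ generalizing σ with
  | rat r => exact h.elim
  | sim s t =>
    rcases h with h | h <;> obtain ⟨z, hz, hz'⟩ := Term.exists_occurs_of_substAll h
    exacts [⟨z, .inl hz, hz'⟩, ⟨z, .inr hz, hz'⟩]
  | rel R a =>
    obtain ⟨i, hi⟩ := h
    obtain ⟨z, hz, hz'⟩ := Term.exists_occurs_of_substAll hi
    exact ⟨z, ⟨i, hz⟩, hz'⟩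
  | imp φ ψ ihφ ihψ =>
    rcases h with h | h
    · obtain ⟨z, hz, hz'⟩ := ihφ h; exact ⟨z, .inl hz, hz'⟩
    · obtain ⟨z, hz, hz'⟩ := ihψ h; exact ⟨z, .inr hz, hz'⟩
  | all y φ ih =>
    obtain ⟨hyx, h⟩ := h
    obtain ⟨z, hz, hz'⟩ := ih h
    by_cases hzy : z = y
    · subst hzy
      exact absurd (by simpa [Term.Occurs] using hz') hyx
    · exact ⟨z, ⟨Ne.symm hzy, hz⟩, by simpa [hzy] using hz'⟩

theorem isSentence_substAll {σ : ℕ → Term L} (hσ : ∀ z, (σ z).IsClosed) (φ : Formula L) :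
    (φ.substAll σ).IsSentence := fun _ h =>
  have ⟨_, _, hz⟩ := exists_free_of_substAll h
  hσ _ _ hz

theorem foldl_subst_eq_substAll_ite {σ : ℕ → Term L} (hσ : ∀ z, (σ z).IsClosed) (φ : Formula L)
    (n : ℕ) : (List.range n).foldl (fun ψ i => ψ.subst i (σ i)) φ =
      φ.substAll fun i => if i < n then σ i else .var i := by
  induction n with
  | zero => simpa using φ.substAll_var.symm
  | succ n ih =>
    rw [List.range_succ, List.foldl_append, ih, List.foldl_cons, List.foldl_nil, subst_substAll]
    · congr 1
      funext i
      by_cases h : i = n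
      · simp [h]
      · simp [h, Nat.le_iff_lt_or_eq]
    · intro z hz
      split_ifs
      · exact hσ _ _
      · exact hz
    · simp

theorem foldl_subst_eq_substAll {σ : ℕ → Term L} (hσ : ∀ z, (σ z).IsClosed) {φ : Formula L}
    {n : ℕ} (hn : ∀ x, φ.Free x → x < n) :
    (List.range n).foldl (fun ψ i => ψ.subst i (σ i)) φ = φ.substAll σ := by
  rw [foldl_subst_eq_substAll_ite hσ]
  exact substAll_congr fun x hx => if_pos (hn x hx)

theorem exists_forall_free_lt (φ : Formula L) : ∃ n, ∀ x, φ.Free x → x < n :=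
  ⟨φ.freeVars.sum + 1,
    fun _ hx => Nat.lt_succ_of_le (List.le_sum_of_mem (mem_freeVars.2 hx))⟩

end Formula

namespace Provable

theorem subst {φ : Formula L} (h : Provable T φ) {x : ℕ} {t : Term L} (ht : FreeFor t x φ) :
    Provable T (φ.subst x t) :=
  .mp (.gen x h) (.all1 x φ t ht)

theorem substAll {φ : Formula L} (h : Provable T φ) {σ : ℕ → Term L}
    (hσ : ∀ z, (σ z).IsClosed) : Provable T (φ.substAll σ) := by
  obtain ⟨n, hn⟩ := φ.exists_forall_free_lt
  rw [← foldl_subst_eq_substAll hσ hn]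
  exact List.foldlRecOn _ _ h fun _ hψ i _ => hψ.subst ((hσ i).freeFor _ _)

theorem all_imp_self (x : ℕ) (φ : Formula L) : Provable T (imp (all x φ) φ) := by
  simpa only [subst_self] using all1 (T := T) x φ (.var x) (freeFor_self x φ)

theorem ex_intro {x : ℕ} {φ : Formula L} {t : Term L} (ht : FreeFor t x φ)
    (h : Provable T (φ.subst x t)) : Provable T (ex x φ) :=
  h.mp (swap (all1 x (neg φ) t ⟨ht, trivial⟩))

theorem ex_imp {x : ℕ} {φ ψ : Formula L} (hx : ¬ ψ.Free x) (h : Provable T (imp (all x φ) ψ)) :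
    Provable T (ex x (imp φ ψ)) := by
  set B := ex x (imp φ ψ) with hB
  have hBx : ¬ B.Free x := by simp [hB, ex, neg, Free, bot]
  have imp_B : Provable T (imp (imp φ ψ) B) := (all_imp_self x (neg (imp φ ψ))).swap
  have to_φ : Provable T (imp (imp B ψ) (imp (imp ψ (all x φ)) φ)) :=
    ((imp_B.imp_left ψ).imp_trans (l3 φ ψ)).imp_trans
      (((all_imp_self x φ).imp_right ψ).imp_left φ)
  have to_all : Provable T (imp (imp B ψ) (imp (imp ψ (all x φ)) (all x φ))) :=
    (mp (gen x to_φ) (all2 x _ _ (by simp [Free, hBx, hx]))).imp_trans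
      (all2 x _ _ (by simp [Free, hx]))
  have to_ψ : Provable T (imp (imp B ψ) ψ) := h.mp (to_all.imp_trans (l3 ψ (all x φ))).swap
  have ψ_imp : Provable T (imp ψ B) := (l1 ψ φ).imp_trans imp_B
  exact ψ_imp.mp (to_ψ.mp (l3 B ψ))

end Provable

end Logic

section ProvabilityDegree

variable {L : Lang} {T : Set (Formula L)}

open Formula

namespace UnitRat

theorem coe_tsub (s r : UnitRat) : ((s.tsub r).1 : ℝ) = max ((s.1 : ℝ) - r.1) 0 := by
  simp [tsub]

theorem exists_btwn {x y : ℝ} (hx : 0 ≤ x) (hxy : x < y) (hy : y ≤ 1) :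
    ∃ r : UnitRat, x < r.1 ∧ (r.1 : ℝ) < y := by
  obtain ⟨q, hxq, hqy⟩ := exists_rat_btwn hxy
  have h0 : 0 ≤ q := by exact_mod_cast (hx.trans_lt hxq).le
  have h1 : q ≤ 1 := by exact_mod_cast (hqy.trans_le hy).le
  exact ⟨⟨q, h0, h1⟩, hxq, hqy⟩

end UnitRat

section Degree

variable {φ ψ : Formula L}

theorem provDeg_bddBelow (φ : Formula L) :
    BddBelow {x : ℝ | ∃ r : UnitRat, x = r.1 ∧ Provable T (imp (rat r) φ)} :=
  ⟨0, by rintro _ ⟨r, rfl, -⟩; exact_mod_cast r.2.1⟩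

theorem provDeg_nonempty (φ : Formula L) :
    {x : ℝ | ∃ r : UnitRat, x = r.1 ∧ Provable T (imp (rat r) φ)}.Nonempty :=
  ⟨_, _, rfl, .bot_imp φ⟩

theorem provDeg_le {r : UnitRat} (h : Provable T (imp (rat r) φ)) : provDeg T φ ≤ r.1 :=
  csInf_le (provDeg_bddBelow φ) ⟨r, rfl, h⟩

theorem le_provDeg_of_forall {x : ℝ}
    (h : ∀ r : UnitRat, Provable T (imp (rat r) φ) → x ≤ r.1) : x ≤ provDeg T φ :=
  le_csInf (provDeg_nonempty φ) (by rintro _ ⟨r, rfl, hr⟩; exact h r hr)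

theorem provDeg_nonneg (φ : Formula L) : 0 ≤ provDeg T φ :=
  le_provDeg_of_forall fun r _ => by exact_mod_cast r.2.1

theorem provDeg_le_one (φ : Formula L) : provDeg T φ ≤ 1 :=
  (provDeg_le (.bot_imp φ)).trans (by simp)

theorem exists_provable_rat_imp {x : ℝ} (h : provDeg T φ < x) :
    ∃ r : UnitRat, (r.1 : ℝ) < x ∧ Provable T (imp (rat r) φ) := by
  obtain ⟨_, ⟨r, rfl, hr⟩, hx⟩ := exists_lt_of_csInf_lt (provDeg_nonempty φ) h
  exact ⟨r, hx, hr⟩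

theorem provDeg_anti (h : Provable T (imp φ ψ)) : provDeg T ψ ≤ provDeg T φ :=
  le_provDeg_of_forall fun _ hr => provDeg_le (hr.imp_trans h)

theorem provDeg_eq_zero (h : Provable T φ) : provDeg T φ = 0 :=
  le_antisymm (by simpa using provDeg_le (h.imp_intro (rat 0))) (provDeg_nonneg φ)

theorem le_provDeg (hT : Consistent T) {r : UnitRat} (h : Provable T (imp φ (rat r))) :
    r.1 ≤ provDeg T φ :=
  le_provDeg_of_forall fun _ hs => by exact_mod_cast (hs.imp_trans h).le_of_rat_imp_rat hT

theorem provDeg_rat (hT : Consistent T) (r : UnitRat) : provDeg T (rat r) = r.1 :=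
  le_antisymm (provDeg_le (.imp_self _)) (le_provDeg hT (.imp_self _))

theorem exists_provable_imp_rat (hlin : LinearComplete T) (hφ : φ.IsSentence) {x : ℝ}
    (h : x < provDeg T φ) : ∃ r : UnitRat, x < r.1 ∧ Provable T (imp φ (rat r)) := by
  rcases lt_or_ge x 0 with hx | hx
  · exact ⟨0, by simpa using hx, Provable.rat_zero.imp_intro _⟩
  · obtain ⟨r, hxr, hr⟩ := UnitRat.exists_btwn hx h (provDeg_le_one φ)
    have not_imp : ¬ Provable T (imp (rat r) φ) := fun h' => hr.not_ge (provDeg_le h')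
    exact ⟨r, hxr, (hlin φ (rat r) hφ fun _ h => h).resolve_right not_imp⟩

theorem provDeg_imp_le (hlin : LinearComplete T) (hφ : φ.IsSentence) :
    provDeg T (imp φ ψ) ≤ max (provDeg T ψ - provDeg T φ) 0 := by
  refine le_of_forall_pos_le_add fun ε hε => ?_
  obtain ⟨s, hs, s_imp⟩ := exists_provable_rat_imp
    (show provDeg T ψ < provDeg T ψ + ε / 2 by linarith)
  obtain ⟨r, hr, imp_r⟩ := exists_provable_imp_rat hlin hφ
    (show provDeg T φ - ε / 2 < provDeg T φ by linarith)
  have tsub_imp : Provable T (imp (rat (s.tsub r)) (imp φ ψ)) :=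
    (Provable.rat_tsub_imp r s).imp_trans ((imp_r.imp_left _).imp_trans (s_imp.imp_right _))
  calc provDeg T (imp φ ψ) ≤ max ((s.1 : ℝ) - r.1) 0 := s.coe_tsub r ▸ provDeg_le tsub_imp
    _ ≤ max (provDeg T ψ - provDeg T φ + ε) (0 + ε) := max_le_max (by linarith) (by linarith)
    _ = max (provDeg T ψ - provDeg T φ) 0 + ε := max_add_add_right _ _ _

theorem le_provDeg_imp (hT : Consistent T) (hlin : LinearComplete T) (hψ : ψ.IsSentence) :
    max (provDeg T ψ - provDeg T φ) 0 ≤ provDeg T (imp φ ψ) := by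
  refine max_le (le_of_forall_pos_le_add fun ε hε => ?_) (provDeg_nonneg _)
  obtain ⟨r, hr, r_imp⟩ := exists_provable_rat_imp
    (show provDeg T φ < provDeg T φ + ε / 2 by linarith)
  obtain ⟨s, hs, imp_s⟩ := exists_provable_imp_rat hlin hψ
    (show provDeg T ψ - ε / 2 < provDeg T ψ by linarith)
  have imp_tsub : Provable T (imp (imp φ ψ) (rat (s.tsub r))) :=
    ((r_imp.imp_left _).imp_trans (imp_s.imp_right _)).imp_trans (.imp_rat_tsub r s)
  calc provDeg T ψ - provDeg T φ ≤ max ((s.1 : ℝ) - r.1) 0 + ε := by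
        linarith [le_max_left ((s.1 : ℝ) - r.1) 0]
    _ ≤ provDeg T (imp φ ψ) + ε := by gcongr; exact s.coe_tsub r ▸ le_provDeg hT imp_tsub

theorem provDeg_imp (hT : Consistent T) (hlin : LinearComplete T) (hφ : φ.IsSentence)
    (hψ : ψ.IsSentence) : provDeg T (imp φ ψ) = max (provDeg T ψ - provDeg T φ) 0 :=
  le_antisymm (provDeg_imp_le hlin hφ) (le_provDeg_imp hT hlin hψ)

theorem provDeg_subst_le (x : ℕ) (φ : Formula L) {t : Term L} (ht : t.IsClosed) :
    provDeg T (φ.subst x t) ≤ provDeg T (all x φ) :=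
  provDeg_anti (.all1 x φ t (ht.freeFor _ _))

theorem exists_const_lt_provDeg_subst (hT : Consistent T) (hlin : LinearComplete T)
    (hH : IsHenkin T) {x : ℕ} (hφ : (all x φ).IsSentence) {y : ℝ}
    (h : y < provDeg T (all x φ)) : ∃ c : L.Const, y < provDeg T (φ.subst x (.const c)) := by
  obtain ⟨r, hyr, imp_r⟩ := exists_provable_imp_rat hlin hφ h
  have sentence : (ex x (imp φ (rat r))).IsSentence := fun z hz =>
    hφ z (by simpa [ex, neg, Free, bot] using hz)
  obtain ⟨c, hc⟩ := hH x _ sentence (Provable.ex_imp id imp_r)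
  exact ⟨c, hyr.trans_le (le_provDeg hT hc)⟩

theorem nonempty_const (hH : IsHenkin T) : Nonempty L.Const := by
  have ex_bot : Provable T (ex 0 (imp bot bot)) := .ex_imp id (.all1 0 bot (.var 0) trivial)
  obtain ⟨c, -⟩ := hH 0 (imp bot bot) (fun z hz => by simp [ex, neg, Free, bot] at hz) ex_bot
  exact ⟨c⟩

theorem iSup_provDeg_subst (hT : Consistent T) (hlin : LinearComplete T) (hH : IsHenkin T)
    {ι : Type*} [Nonempty ι] {τ : ι → Term L} (hτ : ∀ a, (τ a).IsClosed)
    (hconst : ∀ c, ∃ a, τ a = .const c) {x : ℕ} (hφ : (all x φ).IsSentence) :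
    ⨆ a, provDeg T (φ.subst x (τ a)) = provDeg T (all x φ) := by
  refine ciSup_eq_of_forall_le_of_forall_lt_exists_gt
    (fun a => provDeg_subst_le x φ (hτ a)) fun y hy => ?_
  obtain ⟨c, hc⟩ := exists_const_lt_provDeg_subst hT hlin hH hφ hy
  obtain ⟨a, ha⟩ := hconst c
  exact ⟨a, ha ▸ hc⟩

end Degree

section Similarity

variable {s t u s' t' : Term L}

theorem isSentence_sim (hs : s.IsClosed) (ht : t.IsClosed) : (sim s t).IsSentence :=
  fun x hx => hx.elim (hs x) (ht x)

namespace Provable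

theorem sim_refl (hs : s.IsClosed) : Provable T (sim s s) :=
  (refl 0).substAll (σ := fun _ => s) fun _ => hs

theorem sim_symm (hs : s.IsClosed) (ht : t.IsClosed) :
    Provable T (imp (sim s t) (sim t s)) :=
  (symm 0 1).substAll (σ := fun | 0 => s | _ => t) (by rintro (_ | _); exacts [hs, ht])

theorem sim_trans (hs : s.IsClosed) (ht : t.IsClosed) (hu : u.IsClosed) :
    Provable T (imp (sim s t) (imp (sim t u) (sim s u))) :=
  ((trans 0 1 2).substAll (σ := fun | 0 => s | 1 => t | _ => u)
    (by rintro (_ | _ | _); exacts [hs, ht, hu])).oplus_curry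

end Provable

theorem provDeg_sim_self (hs : s.IsClosed) : provDeg T (sim s s) = 0 :=
  provDeg_eq_zero (.sim_refl hs)

theorem provDeg_sim_comm (hs : s.IsClosed) (ht : t.IsClosed) :
    provDeg T (sim s t) = provDeg T (sim t s) :=
  le_antisymm (provDeg_anti (.sim_symm ht hs)) (provDeg_anti (.sim_symm hs ht))

theorem provDeg_sim_triangle (hT : Consistent T) (hlin : LinearComplete T) (hs : s.IsClosed)
    (ht : t.IsClosed) (hu : u.IsClosed) :
    provDeg T (sim s u) ≤ provDeg T (sim s t) + provDeg T (sim t u) :=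
  sub_le_iff_le_add.1 <| calc
    provDeg T (sim s u) - provDeg T (sim t u)
      ≤ max (provDeg T (sim s u) - provDeg T (sim t u)) 0 := le_max_left _ _
    _ ≤ provDeg T (imp (sim t u) (sim s u)) := le_provDeg_imp hT hlin (isSentence_sim hs hu)
    _ ≤ provDeg T (sim s t) := provDeg_anti (.sim_trans hs ht hu)

theorem provDeg_sim_congr_le (hT : Consistent T) (hlin : LinearComplete T) (hs : s.IsClosed)
    (ht : t.IsClosed) (hs' : s'.IsClosed) (ht' : t'.IsClosed)
    (hss' : provDeg T (sim s s') = 0) (htt' : provDeg T (sim t t') = 0) :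
    provDeg T (sim s t) ≤ provDeg T (sim s' t') := by
  linarith [provDeg_sim_triangle hT hlin hs hs' ht, provDeg_sim_triangle hT hlin hs' ht' ht,
    provDeg_sim_comm (T := T) ht ht']

theorem provDeg_sim_congr (hT : Consistent T) (hlin : LinearComplete T) (hs : s.IsClosed)
    (ht : t.IsClosed) (hs' : s'.IsClosed) (ht' : t'.IsClosed)
    (hss' : provDeg T (sim s s') = 0) (htt' : provDeg T (sim t t') = 0) :
    provDeg T (sim s t) = provDeg T (sim s' t') :=
  le_antisymm (provDeg_sim_congr_le hT hlin hs ht hs' ht' hss' htt')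
    (provDeg_sim_congr_le hT hlin hs' ht' hs ht (provDeg_sim_comm hs' hs ▸ hss')
      (provDeg_sim_comm ht' ht ▸ htt'))

end Similarity

end ProvabilityDegree

section NamedStructures

variable {L : Lang} {T : Set (Formula L)}

open Formula

namespace Struc

variable {M : Type}

/-- The elements of a structure are named by closed terms, among which are all constants, in such a
way that the degree of an atomic formula is the provability degree of its instance at the names.
Both models of the theorem are of this kind, and all their properties are derived from it. -/
structure NamedBy (T : Set (Formula L)) (S : Struc L M) (τ : M → Term L) : Prop where
  closed : ∀ a, (τ a).IsClosed
  const : ∀ c, ∃ a, τ a = .const c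
  sim : ∀ (v : ℕ → M) (s t : Term L), S.sim (S.termVal v s) (S.termVal v t) =
    provDeg T (.sim (s.substAll fun i => τ (v i)) (t.substAll fun i => τ (v i)))
  rel : ∀ (v : ℕ → M) (R : L.Rel) (a : Fin (L.relArity R.1) → Term L),
    S.rel R (fun j => S.termVal v (a j)) =
      provDeg T (.rel R fun j => (a j).substAll fun i => τ (v i))

namespace NamedBy

variable {S : Struc L M} {τ : M → Term L}

theorem eval_eq (h : S.NamedBy T τ) (hT : Consistent T) (hlin : LinearComplete T)
    (hH : IsHenkin T) (φ : Formula L) (v : ℕ → M) :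
    S.eval φ v = provDeg T (φ.substAll fun i => τ (v i)) := by
  have closed : ∀ (v : ℕ → M) i, (τ (v i)).IsClosed := fun v i => h.closed _
  induction φ generalizing v with
  | rat r => exact (provDeg_rat hT r).symm
  | sim s t => exact h.sim v s t
  | rel R a => exact h.rel v R a
  | imp φ ψ ihφ ihψ =>
    simp only [Struc.eval, ihφ, ihψ, Formula.substAll]
    rw [provDeg_imp hT hlin (isSentence_substAll (closed v) φ) (isSentence_substAll (closed v) ψ)]
  | all y φ ih =>
    have := S.nonempty
    have instance_eq (a : M) : (φ.substAll fun i => τ (Function.update v y a i)) =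
        (φ.substAll (Function.update (fun i => τ (v i)) y (.var y))).subst y (τ a) := by
      rw [subst_substAll (fun z hz => by simpa [hz] using closed v z y) (by simp),
        Function.update_idem]
      congr 1
      funext i
      exact Function.apply_update (fun _ => τ) v y a i
    simp only [Struc.eval, ih, instance_eq]
    exact iSup_provDeg_subst hT hlin hH h.closed h.const
      (isSentence_substAll (closed v) (all y φ))

theorem models (h : S.NamedBy T τ) (hT : Consistent T) (hlin : LinearComplete T)
    (hH : IsHenkin T) : S.Models T := fun φ hφ v =>
  (h.eval_eq hT hlin hH φ v).trans (provDeg_eq_zero ((Provable.ax hφ).substAll fun _ => h.closed _))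

theorem degree_eq (h : S.NamedBy T τ) (hT : Consistent T) (hlin : LinearComplete T)
    (hH : IsHenkin T) {φ : Formula L} (hφ : φ.IsSentence) : S.degree φ = provDeg T φ := by
  have := S.nonempty
  have eval_eq (v : ℕ → M) : S.eval φ v = provDeg T φ := by
    rw [h.eval_eq hT hlin hH, substAll_of_isSentence hφ]
  simp only [Struc.degree, eval_eq, ciSup_const]

theorem sim_eq (h : S.NamedBy T τ) (a b : M) : S.sim a b = provDeg T (.sim (τ a) (τ b)) :=
  h.sim (fun | 0 => a | _ => b) (.var 0) (.var 1)

theorem simPseudoMetric (h : S.NamedBy T τ) (hT : Consistent T) (hlin : LinearComplete T) :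
    S.SimPseudoMetric := by
  simp only [SimPseudoMetric, h.sim_eq]
  exact ⟨fun a => provDeg_sim_self (h.closed a),
    fun a b => provDeg_sim_comm (h.closed a) (h.closed b),
    fun a b c => provDeg_sim_triangle hT hlin (h.closed a) (h.closed b) (h.closed c)⟩

end NamedBy

end Struc

end NamedStructures

section ElementaryDiagram

section Interval

open Set

variable {β : Type*} [TopologicalSpace β] [LinearOrder β] [OrderTopology β] [DenselyOrdered β]

theorem Ici_mem_nhds_iff [OrderBot β] {p x : β} : Ici p ∈ 𝓝 x ↔ p = ⊥ ∨ p < x := by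
  rcases eq_or_ne p ⊥ with rfl | hp
  · simp
  · rw [← mem_interior_iff_mem_nhds, interior_Ici' ⟨⊥, hp.bot_lt⟩, mem_Ioi, or_iff_right hp]

theorem Iic_mem_nhds_iff [OrderTop β] {q x : β} : Iic q ∈ 𝓝 x ↔ q = ⊤ ∨ x < q :=
  Ici_mem_nhds_iff (β := βᵒᵈ)

theorem approximates_iff {p q : UnitRat} {x : ℝ} (hx : x ∈ Icc (0 : ℝ) 1) :
    Approximates p q x ↔ (p = 0 ∨ (p.1 : ℝ) < x) ∧ (q = 1 ∨ x < q.1) := by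
  let toUnit (r : UnitRat) : unitInterval := ⟨r.1, by exact_mod_cast r.2.1, by exact_mod_cast r.2.2⟩
  have toUnit_eq_bot : toUnit p = ⊥ ↔ p = 0 := by
    rw [Subtype.ext_iff, Subtype.ext_iff]
    exact Rat.cast_eq_zero
  have toUnit_eq_top : toUnit q = ⊤ ↔ q = 1 := by
    rw [Subtype.ext_iff, Subtype.ext_iff]
    change (q.1 : ℝ) = 1 ↔ q.1 = 1
    norm_cast
  have preimage_Icc : Subtype.val ⁻¹' Icc (p.1 : ℝ) q.1 = Ici (toUnit p) ∩ Iic (toUnit q) := rfl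
  rw [Approximates, ← preimage_coe_mem_nhds_subtype (a := ⟨x, hx⟩), preimage_Icc,
    Filter.inter_mem_iff, Ici_mem_nhds_iff, Iic_mem_nhds_iff, toUnit_eq_bot, toUnit_eq_top]
  rfl

end Interval

variable {α : Type*} [Primcodable α]

namespace UnitRat

theorem lt_iff {r s : UnitRat} :
    r < s ↔ r.1.num.natAbs * s.1.den < s.1.num.natAbs * r.1.den := by
  have hr : (0 : ℚ) < r.1.den := Nat.cast_pos.2 r.1.den_pos
  have hs : (0 : ℚ) < s.1.den := Nat.cast_pos.2 s.1.den_pos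
  rw [← Nat.cast_lt (α := ℚ), Nat.cast_mul, Nat.cast_mul, ← val_mul_den, ← val_mul_den,
    mul_right_comm s.1, mul_lt_mul_iff_left₀ hs, mul_lt_mul_iff_left₀ hr, Subtype.coe_lt_coe]

theorem rePred_lt {r s : α → UnitRat} (hr : Effective r) (hs : Effective s) :
    REPred fun a => r a < s a := by
  have lt_code : REPred fun a => ((r a).code.unpair.1 * (s a).code.unpair.2 + 1).ble
      ((s a).code.unpair.1 * (r a).code.unpair.2) = true :=
    rePred_eq (by fun_prop) (computable_const true)
  exact lt_code.of_eq fun a => by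
    simp only [code, Nat.unpair_pair, lt_iff, Nat.ble_eq, Nat.succ_le_iff]

end UnitRat

variable {L : Lang} {T : Set (Formula L)}

open Formula

/-- Proofs from `T` witness that the interval `[p, q]` approximates the degree of `φ`. -/
def ProvablyApproximates (T : Set (Formula L)) (p q : UnitRat) (φ : Formula L) : Prop :=
  (p = 0 ∨ ∃ r, p < r ∧ Provable T (imp φ (rat r))) ∧
    (q = 1 ∨ ∃ r, r < q ∧ Provable T (imp (rat r) φ))

theorem lt_provDeg_iff (hT : Consistent T) (hlin : LinearComplete T) {φ : Formula L}
    (hφ : φ.IsSentence) {p : UnitRat} :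
    p.1 < provDeg T φ ↔ ∃ r, p < r ∧ Provable T (imp φ (rat r)) :=
  ⟨fun h => (exists_provable_imp_rat hlin hφ h).imp fun r hr => ⟨by exact_mod_cast hr.1, hr.2⟩,
    fun ⟨_, hpr, hr⟩ => lt_of_lt_of_le (by exact_mod_cast hpr) (le_provDeg hT hr)⟩

theorem provDeg_lt_iff {φ : Formula L} {q : UnitRat} :
    provDeg T φ < q.1 ↔ ∃ r, r < q ∧ Provable T (imp (rat r) φ) :=
  ⟨fun h => (exists_provable_rat_imp h).imp fun r hr => ⟨by exact_mod_cast hr.1, hr.2⟩,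
    fun ⟨_, hrq, hr⟩ => (provDeg_le hr).trans_lt (by exact_mod_cast hrq)⟩

theorem approximates_provDeg_iff (hT : Consistent T) (hlin : LinearComplete T) {φ : Formula L}
    (hφ : φ.IsSentence) {p q : UnitRat} :
    Approximates p q (provDeg T φ) ↔ ProvablyApproximates T p q φ := by
  rw [approximates_iff ⟨provDeg_nonneg φ, provDeg_le_one φ⟩, lt_provDeg_iff hT hlin hφ,
    provDeg_lt_iff, ProvablyApproximates]

namespace Formula

/-- The instance of a formula at a list of parameters for the variables `0, 1, …`, where the
parameter with the number `k` is named by the term `θ k`. -/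
def substList (θ : ℕ → Term L) (l : List ℕ) (φ : Formula L) : Formula L :=
  (List.range l.length).foldl (fun ψ i => ψ.subst i (θ (l[i]?.getD 0))) φ

theorem substList_map_range {M : Type*} {ν : M → ℕ} {τ : M → Term L} {θ : ℕ → Term L}
    (hτ : ∀ a, (τ a).IsClosed) (hθ : ∀ a, θ (ν a) = τ a) {φ : Formula L} {n : ℕ}
    (hn : ∀ x, φ.Free x → x < n) (v : ℕ → M) :
    φ.substList θ ((List.range n).map fun i => ν (v i)) = φ.substAll fun i => τ (v i) := by
  rw [← foldl_subst_eq_substAll (fun _ => hτ _) hn, substList, List.length_map, List.length_range]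
  exact List.foldl_ext _ _ _ fun ψ i hi => by simp [List.mem_range.1 hi, hθ]

end Formula

theorem effective_foldl {β X : Type*} [Primcodable β] [GodelNumbering X] {f : α → X}
    {l : α → List β} {h : α → X → β → X} (hf : Effective f) (hl : Computable l)
    (hh : Effective fun p : α × ℕ × β => h p.1 (decode X p.2.1) p.2.2) :
    Effective fun a => (l a).foldl (h a) (f a) := by
  have fold_code : Computable fun a => (l a).foldl
      (fun m b => GodelNumbering.code (h a (decode X m) b)) (GodelNumbering.code (f a)) :=
    computable_foldl hl hf hh
  refine fold_code.of_eq fun a => List.foldl_hom _ fun x b => ?_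
  rw [decode_code]

section Effective

variable [Fact L.ComputablyGiven]

@[fun_prop] theorem effective_substList {θ : ℕ → Term L} (hθ : Effective θ) {l : α → List ℕ}
    (hl : Computable l) {φ : α → Formula L} (hφ : Effective φ) :
    Effective fun a => (φ a).substList θ (l a) :=
  effective_foldl (l := fun a => List.range (l a).length)
    (h := fun a (ψ : Formula L) i => ψ.subst i (θ ((l a)[i]?.getD 0)))
    hφ (by fun_prop) (by fun_prop)

theorem rePred_provablyApproximates (hax : ComputablyAxiomatizable T) {p q : α → UnitRat}
    {φ : α → Formula L} (hp : Effective p) (hq : Effective q) (hφ : Effective φ) :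
    REPred fun a => ProvablyApproximates T (p a) (q a) (φ a) :=
  rePred_and
    (rePred_or (rePred_effective_eq hp (effective_const 0)) <| rePred_exists_decode <|
      rePred_and (UnitRat.rePred_lt (by fun_prop) (by fun_prop))
        (rePred_provable hax (by fun_prop)))
    (rePred_or (rePred_effective_eq hq (effective_const 1)) <| rePred_exists_decode <|
      rePred_and (UnitRat.rePred_lt (by fun_prop) (by fun_prop))
        (rePred_provable hax (by fun_prop)))

end Effective

theorem exists_map_range_eq {M : Type*} [Nonempty M] {ν : M → ℕ} {l : List ℕ}
    (hl : ∀ k ∈ l, ∃ a, ν a = k) :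
    ∃ v : ℕ → M, (List.range l.length).map (fun i => ν (v i)) = l := by
  have hl : l ∈ Set.range (List.map ν) := by rwa [Set.range_list_map]
  obtain ⟨m, rfl⟩ := hl
  refine ⟨fun i => m[i]?.getD (Classical.arbitrary M), List.ext_getElem (by simp) fun i h _ => ?_⟩
  have hi : i < m.length := by simpa using h
  simp [hi]

namespace Struc.NamedBy

variable {M : Type} {S : Struc L M} {τ : M → Term L}

theorem diagram_iff (h : S.NamedBy T τ) (hT : Consistent T) (hlin : LinearComplete T)
    (hH : IsHenkin T) {ν : M → ℕ} {θ : ℕ → Term L} (hθ : ∀ a, θ (ν a) = τ a)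
    {w : ℕ × List ℕ × ℕ × ℕ} :
    (∃ (φ : Formula L) (n : ℕ) (v : ℕ → M) (p q : UnitRat), (∀ x, φ.Free x → x < n) ∧
      w = (φ.code, (List.range n).map (fun i => ν (v i)), p.code, q.code) ∧
      Approximates p q (S.eval φ v)) ↔
    ∃ (φ : Formula L) (p q : UnitRat), (∀ k ∈ w.2.1, ∃ a, ν a = k) ∧
      (∀ x ∈ φ.freeVars, x < w.2.1.length) ∧ w = (φ.code, w.2.1, p.code, q.code) ∧
      ProvablyApproximates T p q (φ.substList θ w.2.1) := by
  have approximates_iff (φ : Formula L) (n : ℕ) (v : ℕ → M) (p q : UnitRat)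
      (hn : ∀ x, φ.Free x → x < n) : Approximates p q (S.eval φ v) ↔
        ProvablyApproximates T p q (φ.substList θ ((List.range n).map fun i => ν (v i))) := by
    rw [h.eval_eq hT hlin hH, substList_map_range h.closed hθ hn,
      approximates_provDeg_iff hT hlin (isSentence_substAll (fun _ => h.closed _) φ)]
  constructor
  · rintro ⟨φ, n, v, p, q, hn, rfl, happ⟩
    exact ⟨φ, p, q, by simp, by simpa [mem_freeVars] using hn, rfl,
      (approximates_iff φ n v p q hn).1 happ⟩
  · rintro ⟨φ, p, q, hl, hn, hw, happ⟩
    have := S.nonempty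
    obtain ⟨v, hv⟩ := exists_map_range_eq hl
    simp only [mem_freeVars] at hn
    exact ⟨φ, _, v, p, q, hn, by rwa [hv], (approximates_iff φ _ v p q hn).2 (by rwa [hv])⟩

theorem rePred_diagram [Fact L.ComputablyGiven] (h : S.NamedBy T τ) (hT : Consistent T)
    (hlin : LinearComplete T) (hax : ComputablyAxiomatizable T) (hH : IsHenkin T) {ν : M → ℕ}
    (hν : ComputablePred fun n => ∃ a, ν a = n) {θ : ℕ → Term L} (hθ : Effective θ)
    (hθν : ∀ a, θ (ν a) = τ a) :
    REPred fun w : ℕ × List ℕ × ℕ × ℕ =>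
      ∃ (φ : Formula L) (n : ℕ) (v : ℕ → M) (p q : UnitRat), (∀ x, φ.Free x → x < n) ∧
        w = (φ.code, (List.range n).map (fun i => ν (v i)), p.code, q.code) ∧
        Approximates p q (S.eval φ v) := by
  obtain ⟨isNumber, hisNumber, isNumber_iff⟩ := computablePred_iff_exists_computable.1 hν
  have params : REPred fun w : ℕ × List ℕ × ℕ × ℕ => ∀ k ∈ w.2.1, ∃ a, ν a = k :=
    (rePred_eq (f := fun w : ℕ × List ℕ × ℕ × ℕ => w.2.1.all isNumber) (by fun_prop)
      (computable_const true)).of_eq fun w => by simp [isNumber_iff]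
  refine REPred.of_eq ?_ fun w => (h.diagram_iff hT hlin hH hθν).symm
  refine rePred_exists_decode <| rePred_exists_decode <| rePred_exists_decode <|
    rePred_and (rePred_comp params (by fun_prop)) <| rePred_and ?freeVars <|
      rePred_and (rePred_eq (by fun_prop) (by fun_prop)) <|
        rePred_provablyApproximates hax (by fun_prop) (by fun_prop) (by fun_prop)
  case freeVars =>
    refine (rePred_eq (f := fun x => (decode (Formula L) x.1.1.2).freeVars.all
      fun y => (y + 1).ble x.1.1.1.2.1.length) (by fun_prop) (computable_const true)).of_eq ?_
    simp

end Struc.NamedBy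

end ElementaryDiagram

section Models

variable {L : Lang} {T : Set (Formula L)}

open Formula

/-- The provability degree, as an element of the unit interval. -/
noncomputable def provDegUnit (T : Set (Formula L)) (φ : Formula L) : unitInterval :=
  ⟨provDeg T φ, provDeg_nonneg φ, provDeg_le_one φ⟩

namespace ClosedTerm

/-- A constant, as a closed term. -/
def const (c : L.Const) : ClosedTerm L := ⟨.const c, Term.isClosed_const c⟩

/-- The application of a function symbol to closed terms, as a closed term. -/
def func (f : L.Func) (a : Fin (L.funcArity f.1) → ClosedTerm L) : ClosedTerm L :=
  ⟨.func f fun i => (a i).1, fun x ⟨i, hi⟩ => (a i).2 x hi⟩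

end ClosedTerm

section ClosedTerms

variable [Nonempty L.Const]

/-- The structure on the closed terms in which closed terms denote themselves and atomic sentences
have their provability degrees. -/
noncomputable def termStruc (T : Set (Formula L)) : Struc L (ClosedTerm L) where
  nonempty := Nonempty.map ClosedTerm.const ‹_›
  const := ClosedTerm.const
  func := ClosedTerm.func
  sim s t := provDegUnit T (sim s.1 t.1)
  rel R a := provDegUnit T (rel R fun i => (a i).1)

theorem termVal_termStruc (v : ℕ → ClosedTerm L) (t : Term L) :
    ((termStruc T).termVal v t).1 = t.substAll fun i => (v i).1 := by
  induction t with
  | var x => rfl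
  | const c => rfl
  | func f a ih => exact congrArg (Term.func f) (funext ih)

theorem namedBy_termStruc : (termStruc T).NamedBy T Subtype.val where
  closed t := t.2
  const c := ⟨.const c, rfl⟩
  sim v s t := by
    simp only [← termVal_termStruc (T := T)]
    rfl
  rel v R a := by
    simp only [← termVal_termStruc (T := T)]
    rfl

theorem decidableVia_termStruc [Fact L.ComputablyGiven] (hT : Consistent T)
    (hlin : LinearComplete T) (hax : ComputablyAxiomatizable T) (hH : IsHenkin T) :
    (termStruc T).DecidableVia fun t => t.1.code where
  injective _ _ h := Subtype.ext (Term.code_injective h)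
  universe_decidable := Term.computablePred_closed
  const := ⟨fun n => Nat.pair 1 n, by fun_prop, fun _ => rfl⟩
  func := ⟨fun x => Nat.pair 2 (Nat.pair x.1 (Encodable.encode x.2)), by fun_prop, fun _ _ => rfl⟩
  diagram := namedBy_termStruc.rePred_diagram hT hlin hax hH Term.computablePred_closed
    (θ := decode (Term L)) (by fun_prop) fun t => decode_code t.1

end ClosedTerms

theorem exists_const_provable_sim (hH : IsHenkin T) {t : Term L} (ht : t.IsClosed) :
    ∃ c : L.Const, Provable T (sim t (.const c)) := by
  have subst_eq (s : Term L) : (sim t (.var 0)).subst 0 s = sim t s := by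
    simp [Formula.subst, Term.subst, Term.subst_of_not_occurs (ht 0)]
  have sentence : (ex 0 (sim t (.var 0))).IsSentence := fun x hx => by
    simp only [ex, neg, Free, bot, or_false, Term.Occurs, ht x, false_or] at hx
    exact hx.1 hx.2
  have provable_ex : Provable T (ex 0 (sim t (.var 0))) :=
    .ex_intro (t := t) trivial (subst_eq t ▸ .sim_refl ht)
  simpa only [subst_eq] using hH 0 _ sentence provable_ex

theorem exists_computable_const_provable_sim [Fact L.ComputablyGiven]
    (hax : ComputablyAxiomatizable T) (hH : IsHenkin T) :
    ∃ (F : ClosedTerm L → L.Const) (g : ℕ → ℕ), Computable g ∧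
      (∀ t, g t.1.code = (F t).1) ∧ ∀ t, Provable T (sim t.1 (.const (F t))) := by
  let names (n m : ℕ) : Prop :=
    L.IsConst m ∧ Provable T (sim (decode (Term L) n) (decode (Term L) (Nat.pair 1 m)))
  have rePred_names : REPred fun x : ℕ × ℕ => names x.1 x.2 :=
    rePred_and (rePred_comp (Fact.out : L.ComputablyGiven).const.to_re (by fun_prop))
      (rePred_provable hax (by fun_prop))
  obtain ⟨g, hg, hspec⟩ := exists_computable_choice (r := names) rePred_names
    (d := fun n => (decode (Term L) n).vars.length == 0) (by fun_prop) fun n hn => by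
      have closed : (decode (Term L) n).IsClosed := by
        simpa [Term.IsClosed, List.eq_nil_iff_forall_not_mem, Term.mem_vars] using hn
      obtain ⟨c, hc⟩ := exists_const_provable_sim hH closed
      exact ⟨c.1, c.2, (Term.decode_code (.const c)).symm ▸ hc⟩
  have exists_name (t : ClosedTerm L) : ∃ c : L.Const, g t.1.code = c.1 ∧
      Provable T (sim t.1 (.const c)) := by
    have closed : ((decode (Term L) t.1.code).vars.length == 0) = true := by
      simpa [Term.decode_code, List.eq_nil_iff_forall_not_mem, Term.mem_vars] using t.2
    obtain ⟨hc, h⟩ := hspec _ closed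
    rw [Term.decode_code] at h
    exact ⟨⟨_, hc⟩, rfl, Term.decode_code (L := L) (.const ⟨_, hc⟩) ▸ h⟩
  choose F hgF hF using exists_name
  exact ⟨F, g, hg, hgF, hF⟩

section Constants

variable [Nonempty L.Const] {F : ClosedTerm L → L.Const}

/-- The structure on the constants in which constants denote themselves, the value of a function
is the constant chosen by `F` for the closed term that denotes it, and atomic sentences without
function symbols have their provability degrees. -/
noncomputable def constStruc (T : Set (Formula L)) (F : ClosedTerm L → L.Const) :
    Struc L L.Const where
  nonempty := ‹_›
  const c := c
  func f a := F (.func f fun i => .const (a i))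
  sim a b := provDegUnit T (sim (.const a) (.const b))
  rel R a := provDegUnit T (rel R fun i => .const (a i))

theorem substAll_const_eq [IsEmpty L.Func] (v : ℕ → L.Const) (t : Term L) :
    (t.substAll fun i => .const (v i)) = .const ((constStruc T F).termVal v t) := by
  cases t with
  | func f a => exact (IsEmpty.false f).elim
  | _ => rfl

theorem provDeg_sim_substAll_const (hT : Consistent T) (hlin : LinearComplete T)
    (hF : ∀ t, Provable T (sim t.1 (.const (F t)))) (hcongr : Congruential T) (v : ℕ → L.Const)
    (t : Term L) : provDeg T (sim (t.substAll fun i => .const (v i))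
      (.const ((constStruc T F).termVal v t))) = 0 := by
  have closed (s : Term L) : (s.substAll fun i => .const (v i)).IsClosed :=
    Term.isClosed_substAll (fun _ => Term.isClosed_const _) s
  induction t with
  | var x => exact provDeg_sim_self (Term.isClosed_const _)
  | const c => exact provDeg_sim_self (Term.isClosed_const _)
  | func f a ih =>
    let value : ClosedTerm L := .func f fun i => .const ((constStruc T F).termVal v (a i))
    have arguments : provDeg T (sim ((Term.func f a).substAll fun i => .const (v i)) value.1) = 0 :=
      hcongr.2 f _ _ (fun i => closed (a i)) (fun i => Term.isClosed_const _) ih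
    have choice : provDeg T (sim value.1 (.const (F value))) = 0 := provDeg_eq_zero (hF value)
    refine le_antisymm ?_ (provDeg_nonneg _)
    calc provDeg T (sim ((Term.func f a).substAll fun i => .const (v i)) (.const (F value)))
        ≤ _ + _ := provDeg_sim_triangle hT hlin (closed _) value.2 (Term.isClosed_const _)
      _ = 0 := by rw [arguments, choice, add_zero]

theorem namedBy_constStruc (hT : Consistent T) (hlin : LinearComplete T)
    (hF : ∀ t, Provable T (sim t.1 (.const (F t)))) (hcongr : IsEmpty L.Func ∨ Congruential T) :
    (constStruc T F).NamedBy T Term.const := by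
  have closed (v : ℕ → L.Const) (t : Term L) : (t.substAll fun i => .const (v i)).IsClosed :=
    Term.isClosed_substAll (fun _ => Term.isClosed_const _) t
  refine ⟨Term.isClosed_const, fun c => ⟨c, rfl⟩, fun v s t => ?_, fun v R a => ?_⟩ <;>
    rcases hcongr with _ | hcongr
  · simp only [substAll_const_eq (T := T) (F := F)]
    rfl
  · exact (provDeg_sim_congr hT hlin (closed v s) (closed v t) (Term.isClosed_const _)
      (Term.isClosed_const _) (provDeg_sim_substAll_const hT hlin hF hcongr v s)
      (provDeg_sim_substAll_const hT hlin hF hcongr v t)).symm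
  · simp only [substAll_const_eq (T := T) (F := F)]
    rfl
  · exact (hcongr.1 R _ _ (fun i => closed v (a i)) (fun _ => Term.isClosed_const _)
      fun i => provDeg_sim_substAll_const hT hlin hF hcongr v (a i)).symm

theorem decidableVia_constStruc [Fact L.ComputablyGiven] (hT : Consistent T)
    (hlin : LinearComplete T) (hax : ComputablyAxiomatizable T) (hH : IsHenkin T)
    (h : (constStruc T F).NamedBy T Term.const) {g : ℕ → ℕ} (hg : Computable g)
    (hgF : ∀ t, g t.1.code = (F t).1) : (constStruc T F).DecidableVia fun c => c.1 := by
  have universe_decidable : ComputablePred fun n => ∃ c : L.Const, c.1 = n :=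
    (Fact.out : L.ComputablyGiven).const.of_eq fun n =>
      ⟨fun hn => ⟨⟨n, hn⟩, rfl⟩, fun ⟨c, hc⟩ => hc ▸ c.2⟩
  exact
  { injective := Subtype.val_injective
    universe_decidable
    const := ⟨id, computable_id, fun _ => rfl⟩
    func := ⟨fun x => g (Nat.pair 2 (Nat.pair x.1 (Encodable.encode (x.2.map (Nat.pair 1))))),
      by fun_prop, fun f a =>
        .trans (by simp only [List.map_ofFn]; rfl) (hgF (.func f fun i => .const (a i)))⟩
    diagram := h.rePred_diagram hT hlin hax hH universe_decidable
      (θ := fun n => decode (Term L) (Nat.pair 1 n)) (by fun_prop)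
      fun c => Term.decode_code (.const c) }

end Constants

end Models

end RPL

theorem theorem3p5 (L : RPL.Lang) (hL : L.ComputablyGiven) (T : Set (RPL.Formula L))
    (hcons : RPL.Consistent T) (hlin : RPL.LinearComplete T)
    (hax : RPL.ComputablyAxiomatizable T) (hHenkin : RPL.IsHenkin T) :
    -- a decidable model on the closed terms, which denote themselves
    (∃ S : RPL.Struc L (RPL.ClosedTerm L),
      (∀ c, (S.const c).1 = RPL.Term.const c) ∧
      (∀ f a, (S.func f a).1 = RPL.Term.func f fun i => (a i).1) ∧
      (∀ s t, (S.sim s t : ℝ) = RPL.provDeg T (RPL.Formula.sim s.1 t.1)) ∧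
      S.SimPseudoMetric ∧
      S.Models T ∧
      (∀ φ : RPL.Formula L, φ.IsSentence → S.degree φ = RPL.provDeg T φ) ∧
      S.DecidableVia (fun t => t.1.code)) ∧
    -- a decidable model on the constants, which denote themselves
    (IsEmpty L.Func ∨ RPL.Congruential T →
      ∃ S : RPL.Struc L L.Const,
        (∀ c, S.const c = c) ∧
        (∀ f a, RPL.Provable T (RPL.Formula.sim
          (RPL.Term.func f fun i => RPL.Term.const (a i)) (RPL.Term.const (S.func f a)))) ∧
        (∀ a b, (S.sim a b : ℝ) =
          RPL.provDeg T (RPL.Formula.sim (RPL.Term.const a) (RPL.Term.const b))) ∧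
        S.SimPseudoMetric ∧
        S.Models T ∧
        (∀ φ : RPL.Formula L, φ.IsSentence → S.degree φ = RPL.provDeg T φ) ∧
        S.DecidableVia (fun c => c.1)) := by
  have : Fact L.ComputablyGiven := ⟨hL⟩
  have : Nonempty L.Const := RPL.nonempty_const hHenkin
  constructor
  · have named := RPL.namedBy_termStruc (T := T)
    exact ⟨RPL.termStruc T, fun _ => rfl, fun _ _ => rfl, fun _ _ => rfl,
      named.simPseudoMetric hcons hlin, named.models hcons hlin hHenkin,
      fun _ => named.degree_eq hcons hlin hHenkin,
      RPL.decidableVia_termStruc hcons hlin hax hHenkin⟩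
  · intro hcongr
    obtain ⟨F, g, hg, hgF, hF⟩ := RPL.exists_computable_const_provable_sim hax hHenkin
    have named := RPL.namedBy_constStruc hcons hlin hF hcongr
    exact ⟨RPL.constStruc T F, fun _ => rfl,
      fun f a => hF (.func f fun i => .const (a i)), fun _ _ => rfl,
      named.simPseudoMetric hcons hlin, named.models hcons hlin hHenkin,
      fun _ => named.degree_eq hcons hlin hHenkin,
      RPL.decidableVia_constStruc hcons hlin hax hHenkin named hg hgF⟩
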